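/- Let $n$ be a natural number, let $Q=[-1/2,1/2]^n$, and let $C_0^\infty$ denote the complex-valued smooth functions with compact support. For a bounded function $\sigma$ on $\mathbb{R}^n\times\mathbb{R}^n$ (measurable) and Schwartz functions $f,g$ on $\mathbb{R}^n$ put $$T_\sigma(f,g)(x)=\iint_{\mathbb{R}^n\times\mathbb{R}^n}e^{2\pi i x\cdot(\xi+\eta)}\sigma(\xi,\eta)\widehat f(\xi)\widehat g(\eta)\,d\xi\,d\eta,\qquad \widehat f(\xi)=\int_{\mathbb{R}^n} e^{-2\pi i x\cdot\xi}f(x)\,dx.$$ For $1\le q\le\infty$ let $\|h\|_{(L^2,\ell^q)}$ be the $\ell^q$ norm over $\nu\in\mathbb{Z}^n$ of the numbers $\big(\int_Q|h(x+\nu)|^2dx\big)^{1/2}$, and let $$\|\sigma\|_{\mathcal M(L^2\times L^2\to(L^2,\ell^q))}=\sup\{\|T_\sigma(f,g)\|_{(L^2,\ell^q)} : f,g\in\mathcal S(\mathbb{R}^n),\ \|f\|_{L^2}=\|g\|_{L^2}=1\}\in[0,\infty].$$ An $L^\infty$ matrix is a family $A=(a_{\mu,\nu})_{\mu,\nu\in\mathbb{Z}^n}$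 of complex numbers with $\sup_{\mu,\nu}|a_{\mu,\nu}|<\infty$. For such $A$ let $$\|A\|_{\mathcal B}=\sup\Big|\sum_{\mu,\nu\in\mathbb{Z}^n}a_{\mu,\nu}F(\mu)G(\nu)H(\mu+\nu)\Big|\in[0,\infty],$$ the supremum being over all finitely supported $F,G,H:\mathbb{Z}^n\to\mathbb{C}$ with $\|F\|_{\ell^2}=\|G\|_{\ell^2}=\|H\|_{\ell^2}=1$, and, for $\Phi\in C_0^\infty(\mathbb{R}^n\times\mathbb{R}^n)$, let $\sigma_{A,\Phi}(\xi,\eta)=\sum_{\mu,\nu\in\mathbb{Z}^n}a_{\mu,\nu}\Phi(\xi-\mu,\eta-\nu)$. (1) For every $\Phi\in C_0^\infty(\mathbb{R}^n\times\mathbb{R}^n)$ there is a constant $c\in(0,\infty)$, depending only on $n$ and $\Phi$, such that $$\|\sigma_{A,\Phi}\|_{\mathcal M(L^2\times L^2\to(L^2,\ell^1))}\le c\,\|A\|_{\mathcal B}$$ for all $L^\infty$ matrices $A$. (2) Suppose that $\Phi\in C_0^\infty(\mathbb{R}^n\times\mathbb{R}^n)$ satisfies condition (A): there is a function $\Theta\in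 C_0^\infty(\mathbb{R}^n\times\mathbb{R}^n)$ such that, for $\alpha,\beta\in\mathbb{Z}^n$, the integral $\iint\Theta(\xi,\eta)\Phi(\xi-\alpha,\eta-\beta)\,d\xi\,d\eta$ equals $1$ if $(\alpha,\beta)=(0,0)$ and $0$ otherwise. Then there is a constant $c\in(0,\infty)$, depending only on $n$ and $\Phi$, such that $$\|\sigma_{A,\Phi}\|_{\mathcal M(L^2\times L^2\to(L^2,\ell^\infty))}\ge c^{-1}\|A\|_{\mathcal B}$$ for all $L^\infty$ matrices $A$. -/

import Mathlib

open MeasureTheory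
open scoped ENNReal NNReal SchwartzMap FourierTransform ContDiff

noncomputable section

namespace BilinearMultiplier

/-- The Euclidean space `ℝⁿ`. -/
abbrev Rn (n : ℕ) : Type := EuclideanSpace ℝ (Fin n)

/-- The integer lattice `ℤⁿ`. -/
abbrev Zn (n : ℕ) : Type := Fin n → ℤ

/-- The inclusion of `ℤⁿ` in `ℝⁿ`. -/
def toRn {n : ℕ} (μ : Zn n) : Rn n := WithLp.toLp 2 fun i => (μ i : ℝ)

/-- The class `C₀^∞(V)`: complex-valued smooth functions with compact support. -/
def IsTestFunction {V : Type*} [NormedAddCommGroup V] [NormedSpace ℝ V] (Φ : V → ℂ) : Prop :=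
  ContDiff ℝ ∞ Φ ∧ HasCompactSupport Φ

/-- A matrix on `ℤⁿ × ℤⁿ` is an `L^∞` matrix if its entries are uniformly bounded. -/
def IsBoundedMatrix {n : ℕ} (a : Zn n → Zn n → ℂ) : Prop :=
  ∃ M : ℝ, ∀ μ ν, ‖a μ ν‖ ≤ M

/-- The multiplier `σ_{A,Φ}(ξ, η) = ∑_{μ,ν} a_{μ,ν} Φ(ξ - μ, η - ν)`. For compactly supported `Φ`
only finitely many terms are nonzero at each point. -/
def sigma {n : ℕ} (a : Zn n → Zn n → ℂ) (Φ : Rn n × Rn n → ℂ) : Rn n × Rn n → ℂ :=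
  fun p => ∑' m : Zn n × Zn n, a m.1 m.2 * Φ (p.1 - toRn m.1, p.2 - toRn m.2)

/-- The bilinear Fourier multiplier operator
`T_σ(f, g)(x) = ∬ e^{2πi x·(ξ+η)} σ(ξ, η) f̂(ξ) ĝ(η) dξ dη` on Schwartz functions, with
`f̂(ξ) = ∫ e^{-2πi x·ξ} f(x) dx`. -/
def bilinearOp {n : ℕ} (σ : Rn n × Rn n → ℂ) (f g : 𝓢(Rn n, ℂ)) : Rn n → ℂ :=
  fun x => ∫ p : Rn n × Rn n,
    Complex.exp (2 * Real.pi * Complex.I * (inner ℝ x (p.1 + p.2) : ℝ)) * σ p *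
      𝓕 (f : Rn n → ℂ) p.1 * 𝓕 (g : Rn n → ℂ) p.2

/-- The norm `‖σ‖_{M(X × Y → Z)}`, the supremum of `‖T_σ(f, g)‖_Z` over all Schwartz functions
`f, g` with `‖f‖_X = ‖g‖_Y = 1`; it may be infinite. -/
def multiplierNorm {n : ℕ} (X Y Z : (Rn n → ℂ) → ℝ≥0∞) (σ : Rn n × Rn n → ℂ) : ℝ≥0∞ :=
  ⨆ (f : 𝓢(Rn n, ℂ)) (g : 𝓢(Rn n, ℂ)) (_ : X f = 1) (_ : Y g = 1), Z (bilinearOp σ f g)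

/-- The `L²` norm on `ℝⁿ`. -/
def L2norm {n : ℕ} (f : Rn n → ℂ) : ℝ≥0∞ := eLpNorm f 2 volume

/-- The cube `Q = [-1/2, 1/2]ⁿ`. -/
def cube (n : ℕ) : Set (Rn n) := {x | ∀ i, x i ∈ Set.Icc (-1 / 2 : ℝ) (1 / 2)}

/-- The norm of the amalgam space `(L^p, ℓ^q)`: the `ℓ^q` norm over `ν ∈ ℤⁿ` (the `L^q` norm for
the counting measure) of the `L^p(Q)` norm of `x ↦ f(x + ν)`. -/
def amalgamNorm {n : ℕ} (p q : ℝ≥0∞) (f : Rn n → ℂ) : ℝ≥0∞ :=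
  eLpNorm (fun ν : Zn n => eLpNorm (fun x => f (x + toRn ν)) p (volume.restrict (cube n)))
    q Measure.count

/-- The `ℓ²` norm of a finitely supported function on `ℤⁿ`. -/
def l2norm {n : ℕ} (F : Zn n →₀ ℂ) : ℝ := Real.sqrt (∑ μ ∈ F.support, ‖F μ‖ ^ 2)

/-- The trilinear form `∑_{μ,ν} a_{μ,ν} F(μ) G(ν) H(μ+ν)` on finitely supported functions. -/
def trilinearForm {n : ℕ} (a : Zn n → Zn n → ℂ) (F G H : Zn n →₀ ℂ) : ℂ :=
  ∑ μ ∈ F.support, ∑ ν ∈ G.support, a μ ν * F μ * G ν * H (μ + ν)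

/-- The norm `‖A‖_B`, the supremum of the absolute value of the trilinear form over all finitely
supported `F, G, H` of `ℓ²` norm one; it may be infinite. -/
def Bnorm {n : ℕ} (a : Zn n → Zn n → ℂ) : ℝ≥0∞ :=
  ⨆ (F : Zn n →₀ ℂ) (G : Zn n →₀ ℂ) (H : Zn n →₀ ℂ)
    (_ : l2norm F = 1) (_ : l2norm G = 1) (_ : l2norm H = 1), ‖trilinearForm a F G H‖ₑ

/-- Condition (A) for a function on `ℝⁿ × ℝⁿ`. -/
def ConditionA {n : ℕ} (Φ : Rn n × Rn n → ℂ) : Prop :=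
  ∃ Θ : Rn n × Rn n → ℂ, IsTestFunction Θ ∧
    ∀ α β : Zn n, ∫ p : Rn n × Rn n, Θ p * Φ (p.1 - toRn α, p.2 - toRn β) =
      if α = 0 ∧ β = 0 then 1 else 0

end BilinearMultiplier

end

/-! Both estimates compare `T_σ` on unit cubes with the trigonometric polynomial P(y) = ∑ a_{μ,ν}
F(μ) G(ν) e^{2πi y·(μ+ν)}. By Parseval its L²(Q) norm is the ℓ² norm in τ of the sums of a_{μ,ν}
F(μ) G(ν) over μ + ν = τ. By ℓ² duality, with H as the dual variable, the best bound for that norm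
in terms of ‖F‖ ‖G‖ is exactly ‖A‖_B (`lintegral_bilinTrig_le`, `enorm_trilinearForm_sq_le`).

The bridge is separation of variables (`exists_separation`). For y in Q, the function e^{±2πi
y·(ξ+η)} Φ(ξ,η) extends to a test function of (y,ξ,η). Fourier inversion then writes it as an
integral, against an integrable weight W(w), of products of characters in y, ξ and η. Minkowski's
inequality reduces every estimate to a fixed w, at the cost of the factor ‖W‖_{L¹}.

Upper bound: write x = y + ρ with y in Q and ρ in the lattice, and e^{2πi y·(ξ+η)} = e^{2πi y·(μ+ν)}
e^{2πi y·(ξ-μ+η-ν)}. After separation, T_σ(f,g)(y+ρ) is a superposition of polynomials P whose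
coefficients F_ρ(μ), G_ρ(ν) are Fourier samples at ρ of windowed pieces of f̂, ĝ
(`freqOp_sigmaTrunc_eq`). The L²(Q) norm is at most ‖A‖_B ‖F_ρ‖ ‖G_ρ‖. Cauchy–Schwarz in ρ and
Bessel's inequality (`exists_bessel`, `exists_sum_packetCoeff_le`) make this summable, which gives
ℓ¹. Finite truncations of A are treated first, with uniform constants, and Fatou's lemma removes the
truncation.

Lower bound: condition (A) gives a_{μ,ν} = ∬ σ Θ(·-μ, ·-ν) (`integral_sigma_mul`). Inserting this in
P and separating e^{-2πi y·(ξ+η)} Θ exhibits P, on Q, as a superposition of functions T_σ(f_w,g_w),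
where f̂_w and ĝ_w are sums of translated windows with coefficients F and G
(`bilinTrig_eq_integral_freqOp`). Their L² norms are controlled by ‖F‖ and ‖G‖, and the single cube
Q already sees all of P, so the ℓ^∞ amalgam norm suffices. -/

noncomputable section

namespace BilinearMultiplier

/-! ### Characters, the unit cube and Parseval's identity. -/

/-- The character `t ↦ e^{2πit}` of the real line. -/
def ex (t : ℝ) : ℂ := Complex.exp (2 * Real.pi * Complex.I * t)

lemma ex_add (s t : ℝ) : ex (s + t) = ex s * ex t := by
  simp only [ex, ← Complex.exp_add]; push_cast; ring_nf

@[simp] lemma ex_zero : ex 0 = 1 := by simp [ex]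

@[simp] lemma ex_intCast (m : ℤ) : ex m = 1 := by
  rw [ex, Complex.exp_eq_one_iff]
  exact ⟨m, by push_cast; ring⟩

@[simp] lemma norm_ex (t : ℝ) : ‖ex t‖ = 1 := by
  have : (2 * Real.pi * Complex.I * t : ℂ) = ((2 * Real.pi * t : ℝ) : ℂ) * Complex.I := by
    push_cast; ring
  rw [ex, this, Complex.norm_exp_ofReal_mul_I]

lemma conj_ex (t : ℝ) : (starRingEnd ℂ) (ex t) = ex (-t) := by
  rw [ex, ex, ← Complex.exp_conj]
  simp [Complex.conj_ofNat]

lemma contDiff_ex : ContDiff ℝ ∞ ex := by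
  unfold ex
  exact Complex.contDiff_exp.comp (contDiff_const.mul Complex.ofRealCLM.contDiff)

@[fun_prop] lemma continuous_ex : Continuous ex := contDiff_ex.continuous

variable {n : ℕ}

lemma toRn_add (μ ν : Zn n) : toRn (μ + ν) = toRn μ + toRn ν := by
  ext i; simp [toRn]

lemma toRn_sub (μ ν : Zn n) : toRn (μ - ν) = toRn μ - toRn ν := by
  ext i; simp [toRn]

@[simp] lemma toRn_zero : toRn (0 : Zn n) = 0 := by
  ext i; simp [toRn]

lemma inner_eq_sum (x y : Rn n) : inner ℝ x y = ∑ i, x i * y i := by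
  simp [PiLp.inner_apply, mul_comm]

lemma ex_inner_toRn (μ ν : Zn n) : ex (inner ℝ (toRn μ) (toRn ν)) = 1 := by
  have : inner ℝ (toRn μ) (toRn ν) = ((∑ i, μ i * ν i : ℤ) : ℝ) := by
    rw [inner_eq_sum]; simp [toRn]
  rw [this, ex_intCast]

lemma cube_eq_preimage (n : ℕ) :
    cube n = WithLp.ofLp ⁻¹' (Set.univ.pi fun _ => Set.Icc (-1 / 2 : ℝ) (1 / 2)) := by
  ext x
  simp only [cube, Set.mem_ofPred_eq, Set.mem_preimage, Set.mem_pi, Set.mem_univ, true_imp_iff]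

lemma isCompact_cube (n : ℕ) : IsCompact (cube n) := by
  rw [cube_eq_preimage]
  exact (PiLp.homeomorph 2 (fun _ : Fin n => ℝ)).isCompact_preimage.2
    (isCompact_univ_pi fun _ => isCompact_Icc)

lemma measurableSet_cube (n : ℕ) : MeasurableSet (cube n) :=
  (isCompact_cube n).isClosed.measurableSet

instance isFiniteMeasure_cube (n : ℕ) : IsFiniteMeasure (volume.restrict (cube n)) :=
  ⟨by rw [Measure.restrict_apply_univ]; exact (isCompact_cube n).measure_lt_top⟩

lemma integral_Icc_ex (m : ℤ) :
    ∫ x in Set.Icc (-1 / 2 : ℝ) (1 / 2), ex (x * m) = if m = 0 then 1 else 0 := by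
  rw [integral_Icc_eq_integral_Ioc, ← intervalIntegral.integral_of_le (by norm_num)]
  split_ifs with h
  · subst h; simp; norm_num
  · have hc : (2 * Real.pi * Complex.I * m : ℂ) ≠ 0 := by
      simp [h, Real.pi_ne_zero]
    have : ∀ x : ℝ, ex (x * m) = Complex.exp ((2 * Real.pi * Complex.I * m) * x) := by
      intro x; simp only [ex]; push_cast; ring_nf
    simp_rw [this]
    rw [integral_exp_mul_complex hc]
    have h1 : Complex.exp ((2 * Real.pi * Complex.I * m) * ((1 / 2 : ℝ) : ℂ)) =
        Complex.exp ((2 * Real.pi * Complex.I * m) * ((-1 / 2 : ℝ) : ℂ)) := by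
      rw [Complex.exp_eq_exp_iff_exists_int]
      exact ⟨m, by push_cast; ring⟩
    rw [h1]; simp

lemma integral_cube_ex (τ : Zn n) :
    ∫ y in cube n, ex (inner ℝ y (toRn τ)) = if τ = 0 then 1 else 0 := by
  have h := (PiLp.volume_preserving_ofLp (Fin n)).setIntegral_preimage_emb
    (MeasurableEquiv.toLp 2 (Fin n → ℝ)).symm.measurableEmbedding
    (fun x : Fin n → ℝ => ∏ i, ex (x i * τ i))
    (Set.univ.pi fun _ => Set.Icc (-1 / 2 : ℝ) (1 / 2))
  have h2 : ∀ y : Rn n, ex (inner ℝ y (toRn τ)) = ∏ i, ex (WithLp.ofLp y i * τ i) := by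
    intro y
    rw [inner_eq_sum]
    simp only [ex, ← Complex.exp_sum, toRn]
    congr 1
    push_cast
    rw [Finset.mul_sum]
  simp_rw [h2]
  rw [cube_eq_preimage, h, volume_pi, Measure.restrict_pi_pi,
    integral_fintype_prod_eq_prod (fun i (x : ℝ) => ex (x * τ i))]
  simp_rw [integral_Icc_ex]
  split_ifs with h0
  · subst h0; simp
  · obtain ⟨i, hi⟩ := Function.ne_iff.1 h0
    exact Finset.prod_eq_zero (Finset.mem_univ i) (by simpa using hi)

lemma continuous_trigSum (S : Finset (Zn n)) (c : Zn n → ℂ) :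
    Continuous fun y : Rn n => ∑ τ ∈ S, c τ * ex (inner ℝ y (toRn τ)) := by
  fun_prop

/-- Parseval for trigonometric polynomials: the square is expanded as a double sum, and
orthogonality of the characters on the cube leaves only the diagonal. -/
lemma lintegral_cube_trigSum (S : Finset (Zn n)) (c : Zn n → ℂ) :
    ∫⁻ y in cube n, ‖∑ τ ∈ S, c τ * ex (inner ℝ y (toRn τ))‖ₑ ^ 2 = ∑ τ ∈ S, ‖c τ‖ₑ ^ 2 := by
  have hi : ∀ f : Rn n → ℂ, Continuous f → IntegrableOn f (cube n) := fun f hf =>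
    hf.continuousOn.integrableOn_compact (isCompact_cube n)
  have hcont := continuous_trigSum S c
  have key : ∫ y in cube n, ((‖∑ τ ∈ S, c τ * ex (inner ℝ y (toRn τ))‖ ^ 2 : ℝ) : ℂ) =
      ((∑ τ ∈ S, ‖c τ‖ ^ 2 : ℝ) : ℂ) := by
    have h1 : ∀ y : Rn n, ((‖∑ τ ∈ S, c τ * ex (inner ℝ y (toRn τ))‖ ^ 2 : ℝ) : ℂ) =
        ∑ τ ∈ S, ∑ τ' ∈ S, (c τ * (starRingEnd ℂ) (c τ')) * ex (inner ℝ y (toRn (τ - τ'))) := by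
      intro y
      push_cast
      rw [← Complex.mul_conj', map_sum, Finset.sum_mul_sum]
      refine Finset.sum_congr rfl fun τ _ => Finset.sum_congr rfl fun τ' _ => ?_
      rw [map_mul, conj_ex, toRn_sub, inner_sub_right, sub_eq_add_neg, ex_add]
      ring
    simp_rw [h1]
    rw [integral_finsetSum _ fun τ _ => hi _ (by fun_prop)]
    push_cast
    refine Finset.sum_congr rfl fun τ hτ => ?_
    rw [integral_finsetSum _ fun τ' _ => hi _ (by fun_prop)]
    simp_rw [integral_const_mul, integral_cube_ex, sub_eq_zero]
    simp [hτ, Complex.mul_conj']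
  rw [integral_complex_ofReal] at key
  have key' := Complex.ofReal_injective key
  have h2 : ∀ z : ℂ, ‖z‖ₑ ^ 2 = ENNReal.ofReal (‖z‖ ^ 2) := fun z => by
    rw [← ofReal_norm, ENNReal.ofReal_pow (norm_nonneg _)]
  simp_rw [h2]
  rw [← ofReal_integral_eq_lintegral_ofReal, key', ENNReal.ofReal_sum_of_nonneg]
  · intro i _; positivity
  · exact (hcont.norm.pow 2).continuousOn.integrableOn_compact (isCompact_cube n)
  · exact Filter.Eventually.of_forall fun _ => by positivity

/-! ### Cauchy–Schwarz and Minkowski inequalities in `ℝ≥0∞`. -/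

lemma lintegral_mul_le_sqrt_mul_sqrt {α : Type*} [MeasurableSpace α] (μ : Measure α)
    {f g : α → ℝ≥0∞} (hf : AEMeasurable f μ) (hg : AEMeasurable g μ) :
    ∫⁻ x, f x * g x ∂μ ≤ (∫⁻ x, f x ^ 2 ∂μ) ^ (1 / 2 : ℝ) * (∫⁻ x, g x ^ 2 ∂μ) ^ (1 / 2 : ℝ) := by
  simpa using ENNReal.lintegral_mul_le_Lp_mul_Lq μ Real.HolderConjugate.two_two hf hg

lemma tsum_mul_le_sqrt_mul_sqrt {ι : Type*} (f g : ι → ℝ≥0∞) :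
    ∑' i, f i * g i ≤ (∑' i, f i ^ 2) ^ (1 / 2 : ℝ) * (∑' i, g i ^ 2) ^ (1 / 2 : ℝ) := by
  let _ : MeasurableSpace ι := ⊤
  have := lintegral_mul_le_sqrt_mul_sqrt (Measure.count : Measure ι)
    (f := f) (g := g) measurable_from_top.aemeasurable measurable_from_top.aemeasurable
  simpa only [lintegral_count] using this

lemma sq_rpow_half (x : ℝ≥0∞) : (x ^ 2) ^ (1 / 2 : ℝ) = x := by
  rw [← ENNReal.rpow_natCast, ← ENNReal.rpow_mul]; norm_num

lemma rpow_half_sq (x : ℝ≥0∞) : (x ^ (1 / 2 : ℝ)) ^ 2 = x := by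
  rw [← ENNReal.rpow_natCast, ← ENNReal.rpow_mul]; norm_num

lemma eLpNorm_two_eq {α E : Type*} [MeasurableSpace α] [NormedAddCommGroup E] (μ : Measure α)
    (f : α → E) : eLpNorm f 2 μ = (∫⁻ x, ‖f x‖ₑ ^ 2 ∂μ) ^ (1 / 2 : ℝ) := by
  rw [eLpNorm_eq_lintegral_rpow_enorm_toReal (by norm_num) (by norm_num)]
  simp

lemma eLpNorm_two_sq {α E : Type*} [MeasurableSpace α] [NormedAddCommGroup E] (μ : Measure α)
    (f : α → E) : eLpNorm f 2 μ ^ 2 = ∫⁻ x, ‖f x‖ₑ ^ 2 ∂μ := by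
  rw [eLpNorm_two_eq, rpow_half_sq]

/-- **Minkowski's integral inequality** in `L²`, for nonnegative functions. -/
lemma lintegral_lintegral_sq_le {α β : Type*} [MeasurableSpace α] [MeasurableSpace β]
    (μ : Measure α) (ν : Measure β) [SFinite μ] [SFinite ν] {u : β → α → ℝ≥0∞}
    (hu : Measurable (Function.uncurry u)) :
    ∫⁻ y, (∫⁻ w, u w y ∂ν) ^ 2 ∂μ ≤ (∫⁻ w, (∫⁻ y, u w y ^ 2 ∂μ) ^ (1 / 2 : ℝ) ∂ν) ^ 2 := by
  have h1 : ∀ w, Measurable (u w) := fun w => hu.comp measurable_prodMk_left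
  have h2 : ∀ y, Measurable fun w => u w y := fun y => hu.comp measurable_prodMk_right
  have hN : Measurable fun w => (∫⁻ y, u w y ^ 2 ∂μ) ^ (1 / 2 : ℝ) :=
    (Measurable.lintegral_prod_right' (f := fun p : β × α => u p.1 p.2 ^ 2)
      (hu.pow_const 2)).pow_const _
  -- The square becomes a double integral over `w` and `w'`. The `y`-integral is moved innermost by
  -- Tonelli, and Cauchy–Schwarz in `y` factors the result.
  calc ∫⁻ y, (∫⁻ w, u w y ∂ν) ^ 2 ∂μ
      = ∫⁻ y, ∫⁻ w, ∫⁻ w', u w y * u w' y ∂ν ∂ν ∂μ := by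
        refine lintegral_congr fun y => ?_
        rw [lintegral_lintegral_mul (h2 y).aemeasurable (h2 y).aemeasurable, sq]
    _ = ∫⁻ w, ∫⁻ y, ∫⁻ w', u w y * u w' y ∂ν ∂μ ∂ν := by
        refine lintegral_lintegral_swap (Measurable.aemeasurable ?_)
        refine Measurable.lintegral_prod_right'
          (f := fun p : (α × β) × β => u p.1.2 p.1.1 * u p.2 p.1.1) ?_
        exact (hu.comp (f := fun p : (α × β) × β => (p.1.2, p.1.1)) (by fun_prop)).mul
          (hu.comp (f := fun p : (α × β) × β => (p.2, p.1.1)) (by fun_prop))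
    _ = ∫⁻ w, ∫⁻ w', ∫⁻ y, u w y * u w' y ∂μ ∂ν ∂ν := by
        refine lintegral_congr fun w => lintegral_lintegral_swap (Measurable.aemeasurable ?_)
        exact ((h1 w).comp measurable_fst).mul
          (hu.comp (f := fun p : α × β => (p.2, p.1)) (by fun_prop))
    _ ≤ ∫⁻ w, ∫⁻ w', (∫⁻ y, u w y ^ 2 ∂μ) ^ (1 / 2 : ℝ) *
          (∫⁻ y, u w' y ^ 2 ∂μ) ^ (1 / 2 : ℝ) ∂ν ∂ν :=
        lintegral_mono fun w => lintegral_mono fun w' =>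
          lintegral_mul_le_sqrt_mul_sqrt μ (h1 w).aemeasurable (h1 w').aemeasurable
    _ = _ := by
        rw [lintegral_lintegral_mul hN.aemeasurable hN.aemeasurable, sq]

/-- **Minkowski's integral inequality** in `L²`. -/
lemma eLpNorm_two_integral_le {α β : Type*} [MeasurableSpace α] [MeasurableSpace β]
    (μ : Measure α) (ν : Measure β) [SFinite μ] [SFinite ν] {u : β → α → ℂ}
    (hu : Measurable (Function.uncurry u)) :
    eLpNorm (fun y => ∫ w, u w y ∂ν) 2 μ ≤ ∫⁻ w, eLpNorm (u w) 2 μ ∂ν := by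
  simp_rw [eLpNorm_two_eq]
  rw [← sq_rpow_half (∫⁻ w, (∫⁻ x, ‖u w x‖ₑ ^ 2 ∂μ) ^ (1 / 2 : ℝ) ∂ν)]
  refine ENNReal.rpow_le_rpow (le_trans ?_
    (lintegral_lintegral_sq_le μ ν (u := fun w y => ‖u w y‖ₑ) hu.enorm)) (by norm_num)
  exact lintegral_mono fun y => pow_le_pow_left' (enorm_integral_le_lintegral_enorm _) 2

/-! ### Lattice point counts and Bessel's inequality. -/

/-- A ball of given radius contains a bounded number of lattice points. -/
lemma exists_card_le (n : ℕ) (r : ℝ) : ∃ C : ℕ, ∀ (x : Rn n) (S : Finset (Zn n)),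
    (∀ μ ∈ S, ‖x - toRn μ‖ ≤ r) → S.card ≤ C := by
  -- Each coordinate of an admissible lattice point is an integer in an interval of length `2 * r`,
  -- so it takes at most `⌈2 * r⌉₊ + 1` values.
  refine ⟨(⌈2 * r⌉₊ + 1) ^ n, fun x S hS => ?_⟩
  have hsub : S ⊆ Fintype.piFinset fun i => Finset.Icc ⌈x i - r⌉ (⌈x i - r⌉ + ⌈2 * r⌉₊) := by
    intro μ hμ
    rw [Fintype.mem_piFinset]
    intro i
    have h1 : |x i - μ i| ≤ r := by
      simpa [toRn] using (PiLp.norm_apply_le (x - toRn μ) i).trans (hS μ hμ)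
    rw [abs_le] at h1
    rw [Finset.mem_Icc]
    have h2 : ⌈x i - r⌉ ≤ μ i := Int.ceil_le.2 (by linarith)
    refine ⟨h2, ?_⟩
    have h3 := Int.le_ceil (x i - r)
    have h4 := Nat.le_ceil (2 * r)
    have : (μ i : ℝ) ≤ ((⌈x i - r⌉ + ⌈2 * r⌉₊ : ℤ) : ℝ) := by push_cast; linarith
    exact_mod_cast this
  refine (Finset.card_le_card hsub).trans ?_
  rw [Fintype.card_piFinset]
  simp only [Int.card_Icc]
  have : ∀ i, (⌈x i - r⌉ + (⌈2 * r⌉₊ : ℤ) + 1 - ⌈x i - r⌉).toNat = ⌈2 * r⌉₊ + 1 := by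
    intro i; omega
  simp [this]

lemma finite_lattice_near (x : Rn n) (r : ℝ) : {μ : Zn n | ‖x - toRn μ‖ ≤ r}.Finite := by
  obtain ⟨C, hC⟩ := exists_card_le n r
  by_contra h
  obtain ⟨S, hS, hc⟩ := Set.Infinite.exists_subset_card_eq h (C + 1)
  have := hC x S fun μ hμ => hS hμ
  omega

lemma exists_sub_mem_cube (x : Rn n) : ∃ m : Zn n, x - toRn m ∈ cube n := by
  refine ⟨fun i => round (x i), fun i => ?_⟩
  have := abs_le.1 (abs_sub_round (x i))
  simp only [toRn, PiLp.sub_apply, Set.mem_Icc]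
  constructor <;> linarith

lemma norm_le_of_mem_cube {x : Rn n} (hx : x ∈ cube n) : ‖x‖ ≤ n := by
  rw [EuclideanSpace.norm_eq]
  refine Real.sqrt_le_iff.2 ⟨by positivity, ?_⟩
  have h : ∀ i ∈ Finset.univ, ‖x i‖ ^ 2 ≤ (1 : ℝ) := fun i _ => by
    have := hx i
    rw [Real.norm_eq_abs, sq_abs]
    nlinarith [this.1, this.2]
  refine (Finset.sum_le_sum h).trans ?_
  simp
  exact_mod_cast Nat.le_self_pow (by norm_num) n

/-- The polynomial is periodic under the lattice, because lattice vectors have integer inner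
products. -/
lemma lintegral_translate_cube_trigSum (S : Finset (Zn n)) (c : Zn n → ℂ) (m : Zn n) :
    ∫⁻ y in {x | x - toRn m ∈ cube n}, ‖∑ τ ∈ S, c τ * ex (inner ℝ y (toRn τ))‖ₑ ^ 2 =
      ∑ τ ∈ S, ‖c τ‖ₑ ^ 2 := by
  rw [← lintegral_cube_trigSum]
  have h := (measurePreserving_sub_right (volume : Measure (Rn n)) (toRn m))
    |>.setLIntegral_comp_preimage (measurableSet_cube n)
      (f := fun y => ‖∑ τ ∈ S, c τ * ex (inner ℝ y (toRn τ))‖ₑ ^ 2)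
      ((continuous_trigSum S c).enorm.measurable.pow_const 2)
  rw [← h]
  refine lintegral_congr fun y => ?_
  refine congrArg (fun z : ℂ => ‖z‖ₑ ^ 2) (Finset.sum_congr rfl fun τ _ => ?_)
  have : ex (inner ℝ y (toRn τ)) = ex (inner ℝ (y - toRn m) (toRn τ)) *
      ex (inner ℝ (toRn m) (toRn τ)) := by
    rw [← ex_add, ← inner_add_left, sub_add_cancel]
  rw [this, ex_inner_toRn, mul_one]

/-- Bessel's inequality on balls: the samples at `ℤⁿ` of the inverse Fourier transform of an `L²`
function supported in a ball are square summable. -/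
lemma exists_bessel (n : ℕ) (r : ℝ) : ∃ C : ℕ, ∀ (x₀ : Rn n) (u : Rn n → ℂ),
    Continuous u → Integrable u → (∀ ξ, u ξ ≠ 0 → ‖x₀ - ξ‖ ≤ r) →
    ∑' ρ : Zn n, ‖∫ ξ, ex (inner ℝ (toRn ρ) ξ) * u ξ‖ₑ ^ 2 ≤ C * ∫⁻ ξ, ‖u ξ‖ₑ ^ 2 := by
  obtain ⟨C, hC⟩ := exists_card_le n (r + n)
  refine ⟨C, fun x₀ u hu hui hsupp => ?_⟩
  rw [ENNReal.tsum_eq_iSup_sum]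
  refine iSup_le fun S => ?_
  set v : Zn n → ℂ := fun ρ => ∫ ξ, ex (inner ℝ (toRn ρ) ξ) * u ξ with hv
  set X := ∑ ρ ∈ S, ‖v ρ‖ₑ ^ 2 with hX
  set Y := ∫⁻ ξ, ‖u ξ‖ₑ ^ 2 with hY
  -- Duality: `E` is chosen so that its pairing with `u` is exactly `X`.
  set E : Rn n → ℂ := fun ξ => ∑ ρ ∈ S, (starRingEnd ℂ) (v ρ) * ex (inner ℝ ξ (toRn ρ)) with hE
  have hEc : Continuous E := continuous_trigSum S _
  set M := (finite_lattice_near x₀ (r + n)).toFinset with hM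
  have hMC : M.card ≤ C := hC x₀ M fun μ hμ => by simpa [hM] using hμ
  -- These translated cubes cover the support of `u`. Points of the cube have norm at most `n`, so
  -- centres within `r + n` of `x₀` are enough, and there are at most `C` of them, each contributing
  -- `X` to the integral of `‖E‖²`.
  set B : Set (Rn n) := ⋃ m : M, {x | x - toRn m.1 ∈ cube n} with hB
  have hBm : MeasurableSet B := MeasurableSet.iUnion fun m =>
    (measurable_id.sub_const (toRn m.1)) (measurableSet_cube n)
  have huB : ∀ ξ, ξ ∉ B → u ξ = 0 := by
    intro ξ hξ
    by_contra h
    obtain ⟨m, hm⟩ := exists_sub_mem_cube ξ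
    refine hξ (Set.mem_iUnion.2 ⟨⟨m, ?_⟩, hm⟩)
    have h1 := norm_add_le (x₀ - ξ) (ξ - toRn m)
    rw [sub_add_sub_cancel] at h1
    simpa [hM] using h1.trans (add_le_add (hsupp ξ h) (norm_le_of_mem_cube hm))
  have hEB : ∫⁻ ξ in B, ‖E ξ‖ₑ ^ 2 ≤ C * X := by
    refine (lintegral_iUnion_le _ _).trans ?_
    rw [tsum_fintype]
    simp_rw [hE, lintegral_translate_cube_trigSum]
    simp only [Finset.sum_const, Finset.card_univ, Fintype.card_coe, nsmul_eq_mul, RCLike.enorm_conj, ← hX]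
    gcongr
  have hXE : X = ‖∫ ξ, E ξ * u ξ‖ₑ := by
    have : ∫ ξ, E ξ * u ξ = ((∑ ρ ∈ S, ‖v ρ‖ ^ 2 : ℝ) : ℂ) := by
      simp_rw [hE, Finset.sum_mul]
      rw [integral_finsetSum]
      · push_cast
        refine Finset.sum_congr rfl fun ρ _ => ?_
        simp_rw [mul_assoc, real_inner_comm (toRn ρ)]
        rw [integral_const_mul]
        exact Complex.conj_mul' (v ρ)
      · intro ρ _
        refine hui.bdd_mul (c := ‖v ρ‖) (by fun_prop) (Filter.Eventually.of_forall fun ξ => ?_)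
        simp
    rw [this, hX, ← ofReal_norm, Complex.norm_real, Real.norm_of_nonneg (by positivity),
      ENNReal.ofReal_sum_of_nonneg fun _ _ => by positivity]
    refine Finset.sum_congr rfl fun ρ _ => ?_
    rw [← ofReal_norm, ENNReal.ofReal_pow (norm_nonneg _)]
  have hXtop : X ≠ ⊤ := by
    rw [hX]; exact (ENNReal.sum_lt_top.2 fun ρ _ => ENNReal.pow_lt_top enorm_lt_top).ne
  have hle : X ≤ (C * X) ^ (1 / 2 : ℝ) * Y ^ (1 / 2 : ℝ) := by
    calc X ≤ ∫⁻ ξ, ‖E ξ * u ξ‖ₑ := hXE ▸ enorm_integral_le_lintegral_enorm _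
      _ = ∫⁻ ξ in B, ‖E ξ‖ₑ * ‖u ξ‖ₑ := by
          rw [← lintegral_indicator hBm]
          refine lintegral_congr fun ξ => ?_
          by_cases hξ : ξ ∈ B
          · simp [hξ, enorm_mul]
          · simp [hξ, huB ξ hξ]
      _ ≤ (∫⁻ ξ in B, ‖E ξ‖ₑ ^ 2) ^ (1 / 2 : ℝ) * (∫⁻ ξ in B, ‖u ξ‖ₑ ^ 2) ^ (1 / 2 : ℝ) :=
          lintegral_mul_le_sqrt_mul_sqrt _ hEc.enorm.aemeasurable hu.enorm.aemeasurable
      _ ≤ _ := by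
          gcongr
          exact setLIntegral_le_lintegral _ _
  -- Squaring removes the roots, and one factor `X` then cancels, since it is a finite sum of finite
  -- terms.
  have hsq : X * X ≤ (C * Y) * X := by
    calc X * X ≤ ((C * X) ^ (1 / 2 : ℝ) * Y ^ (1 / 2 : ℝ)) *
          ((C * X) ^ (1 / 2 : ℝ) * Y ^ (1 / 2 : ℝ)) := mul_le_mul' hle hle
      _ = ((C * X) ^ (1 / 2 : ℝ)) ^ 2 * (Y ^ (1 / 2 : ℝ)) ^ 2 := by ring
      _ = (C * Y) * X := by rw [rpow_half_sq, rpow_half_sq]; ring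
  by_cases h0 : X = 0
  · rw [h0]; exact zero_le
  · exact (ENNReal.mul_le_mul_iff_left h0 hXtop).1 hsq

lemma sum_enorm_sq_le_card {ι : Type*} (S : Finset ι) (f : ι → ℂ) :
    ‖∑ i ∈ S, f i‖ₑ ^ 2 ≤ S.card * ∑ i ∈ S, ‖f i‖ₑ ^ 2 := by
  have h : ‖∑ i ∈ S, f i‖₊ ^ 2 ≤ S.card * ∑ i ∈ S, ‖f i‖₊ ^ 2 :=
    (pow_le_pow_left' (nnnorm_sum_le _ _) 2).trans sq_sum_le_card_mul_sum_sq
  simp only [enorm_eq_nnnorm]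
  exact_mod_cast h

/-! ### The trilinear form and its description by trigonometric polynomials. -/

lemma l2norm_eq_of_support_subset (F : Zn n →₀ ℂ) {M : Finset (Zn n)} (hM : F.support ⊆ M) :
    l2norm F = Real.sqrt (∑ μ ∈ M, ‖F μ‖ ^ 2) := by
  rw [l2norm, Finset.sum_subset hM]
  intro μ _ hμ
  simp [Finsupp.notMem_support_iff.1 hμ]

lemma trilinearForm_eq_of_support_subset (a : Zn n → Zn n → ℂ) (F G H : Zn n →₀ ℂ)
    {M N : Finset (Zn n)} (hM : F.support ⊆ M) (hN : G.support ⊆ N) :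
    trilinearForm a F G H = ∑ μ ∈ M, ∑ ν ∈ N, a μ ν * F μ * G ν * H (μ + ν) := by
  rw [trilinearForm, ← Finset.sum_subset hM]
  · refine Finset.sum_congr rfl fun μ _ => Finset.sum_subset hN fun ν _ hν => ?_
    simp [Finsupp.notMem_support_iff.1 hν]
  · intro μ _ hμ
    simp [Finsupp.notMem_support_iff.1 hμ]

lemma l2norm_smul (s : ℂ) (F : Zn n →₀ ℂ) : l2norm (s • F) = ‖s‖ * l2norm F := by
  rw [l2norm_eq_of_support_subset _ Finsupp.support_smul, l2norm]
  simp only [Finsupp.smul_apply, smul_eq_mul, norm_mul, mul_pow, ← Finset.mul_sum]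
  rw [Real.sqrt_mul (by positivity), Real.sqrt_sq (norm_nonneg _)]

lemma trilinearForm_smul (a : Zn n → Zn n → ℂ) (s t u : ℂ) (F G H : Zn n →₀ ℂ) :
    trilinearForm a (s • F) (t • G) (u • H) = s * t * u * trilinearForm a F G H := by
  rw [trilinearForm_eq_of_support_subset a _ _ _ Finsupp.support_smul Finsupp.support_smul,
    trilinearForm]
  simp only [Finset.mul_sum, Finsupp.smul_apply, smul_eq_mul]
  exact Finset.sum_congr rfl fun _ _ => Finset.sum_congr rfl fun _ _ => by ring

lemma l2norm_nonneg (F : Zn n →₀ ℂ) : 0 ≤ l2norm F := Real.sqrt_nonneg _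

lemma eq_zero_of_l2norm_eq_zero {F : Zn n →₀ ℂ} (h : l2norm F = 0) : F = 0 := by
  rw [l2norm, Real.sqrt_eq_zero (by positivity),
    Finset.sum_eq_zero_iff_of_nonneg fun _ _ => by positivity] at h
  ext μ
  by_cases hμ : μ ∈ F.support
  · simpa using h μ hμ
  · simpa using hμ

/-- Follows by homogeneity. A zero argument cannot be normalised, but then the form vanishes, so the
bound holds even when `Bnorm a` is infinite. -/
lemma enorm_trilinearForm_le (a : Zn n → Zn n → ℂ) (F G H : Zn n →₀ ℂ) :
    ‖trilinearForm a F G H‖ₑ ≤ Bnorm a * ENNReal.ofReal (l2norm F) * ENNReal.ofReal (l2norm G) *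
      ENNReal.ofReal (l2norm H) := by
  have key : ∀ F : Zn n →₀ ℂ, F ≠ 0 → ∃ F' : Zn n →₀ ℂ, l2norm F' = 1 ∧
      F = (l2norm F : ℂ) • F' := by
    intro F hF
    have h0 : l2norm F ≠ 0 := fun h => hF (eq_zero_of_l2norm_eq_zero h)
    refine ⟨((l2norm F)⁻¹ : ℂ) • F, ?_, ?_⟩
    · rw [l2norm_smul, norm_inv, Complex.norm_real, Real.norm_of_nonneg (l2norm_nonneg F),
        inv_mul_cancel₀ h0]
    · rw [smul_smul, mul_inv_cancel₀ (by exact_mod_cast h0), one_smul]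
  by_cases hF : F = 0
  · subst hF; simp [trilinearForm]
  by_cases hG : G = 0
  · subst hG; simp [trilinearForm]
  by_cases hH : H = 0
  · subst hH; simp [trilinearForm]
  obtain ⟨F', hF', eF⟩ := key F hF
  obtain ⟨G', hG', eG⟩ := key G hG
  obtain ⟨H', hH', eH⟩ := key H hH
  have hB : ‖trilinearForm a F' G' H'‖ₑ ≤ Bnorm a :=
    le_iSup_of_le F' <| le_iSup_of_le G' <| le_iSup_of_le H' <| le_iSup_of_le hF' <|
      le_iSup_of_le hG' <| le_iSup_of_le hH' le_rfl
  have he : ∀ F : Zn n →₀ ℂ, ‖(l2norm F : ℂ)‖ₑ = ENNReal.ofReal (l2norm F) := fun F => by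
    rw [← ofReal_norm, Complex.norm_real, Real.norm_of_nonneg (l2norm_nonneg F)]
  have e : trilinearForm a F G H =
      l2norm F * l2norm G * l2norm H * trilinearForm a F' G' H' := by
    rw [← trilinearForm_smul, ← eF, ← eG, ← eH]
  rw [e, enorm_mul, enorm_mul, enorm_mul, he, he, he]
  calc _ ≤ ENNReal.ofReal (l2norm F) * ENNReal.ofReal (l2norm G) * ENNReal.ofReal (l2norm H) *
        Bnorm a := by gcongr
    _ = _ := by ring

lemma ofReal_l2norm_sq (F : Zn n →₀ ℂ) {M : Finset (Zn n)} (hM : F.support ⊆ M) :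
    ENNReal.ofReal (l2norm F) ^ 2 = ∑ μ ∈ M, ‖F μ‖ₑ ^ 2 := by
  rw [l2norm_eq_of_support_subset F hM, ← ENNReal.ofReal_pow (Real.sqrt_nonneg _),
    Real.sq_sqrt (by positivity), ENNReal.ofReal_sum_of_nonneg fun _ _ => by positivity]
  refine Finset.sum_congr rfl fun μ _ => ?_
  rw [← ofReal_norm, ENNReal.ofReal_pow (norm_nonneg _)]

/-- The trigonometric polynomial `∑_{μ,ν} a_{μ,ν} F(μ) G(ν) e^{2πi y·(μ+ν)}`. -/
def bilinTrig (a : Zn n → Zn n → ℂ) (M N : Finset (Zn n)) (F G : Zn n → ℂ) (y : Rn n) : ℂ :=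
  ∑ μ ∈ M, ∑ ν ∈ N, a μ ν * F μ * G ν * ex (inner ℝ y (toRn (μ + ν)))

/-- The coefficients of `bilinTrig`. -/
def diagCoeff (a : Zn n → Zn n → ℂ) (M N : Finset (Zn n)) (F G : Zn n → ℂ) (τ : Zn n) : ℂ :=
  ∑ μ ∈ M, ∑ ν ∈ N, if μ + ν = τ then a μ ν * F μ * G ν else 0

/-- Regrouping by `τ = μ + ν`. Taking `h` to be a character gives `bilinTrig`; taking `h = H` gives
the trilinear form. -/
lemma sum_diagCoeff_mul (a : Zn n → Zn n → ℂ) (M N : Finset (Zn n)) (F G h : Zn n → ℂ) :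
    ∑ τ ∈ Finset.image₂ (· + ·) M N, diagCoeff a M N F G τ * h τ =
      ∑ μ ∈ M, ∑ ν ∈ N, a μ ν * F μ * G ν * h (μ + ν) := by
  simp only [diagCoeff, Finset.sum_mul]
  rw [Finset.sum_comm]
  refine Finset.sum_congr rfl fun μ hμ => ?_
  rw [Finset.sum_comm]
  refine Finset.sum_congr rfl fun ν hν => ?_
  have hm : μ + ν ∈ Finset.image₂ (· + ·) M N := Finset.mem_image₂_of_mem hμ hν
  simp only [ite_mul, zero_mul]
  rw [Finset.sum_ite_eq, if_pos hm]

lemma lintegral_bilinTrig_eq (a : Zn n → Zn n → ℂ) (M N : Finset (Zn n)) (F G : Zn n → ℂ) :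
    ∫⁻ y in cube n, ‖bilinTrig a M N F G y‖ₑ ^ 2 =
      ∑ τ ∈ Finset.image₂ (· + ·) M N, ‖diagCoeff a M N F G τ‖ₑ ^ 2 := by
  rw [← lintegral_cube_trigSum]
  refine lintegral_congr fun y => ?_
  rw [bilinTrig, sum_diagCoeff_mul a M N F G fun τ => ex (inner ℝ y (toRn τ))]

/-- First half of the duality: the form is tested on `H` equal to the conjugate of the diagonal
coefficients, so that its value is `X = ‖H‖²`. This gives `X ≤ ‖A‖_B ‖F‖ ‖G‖ X^{1/2}`, which is
squared and divided by `X`. -/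
lemma lintegral_bilinTrig_le (a : Zn n → Zn n → ℂ) (M N : Finset (Zn n)) (F G : Zn n → ℂ) :
    ∫⁻ y in cube n, ‖bilinTrig a M N F G y‖ₑ ^ 2 ≤
      Bnorm a ^ 2 * (∑ μ ∈ M, ‖F μ‖ₑ ^ 2) * ∑ ν ∈ N, ‖G ν‖ₑ ^ 2 := by
  classical
  rw [lintegral_bilinTrig_eq]
  set T := Finset.image₂ (· + ·) M N with hT
  set c := diagCoeff a M N F G with hc
  set X := ∑ τ ∈ T, ‖c τ‖ₑ ^ 2 with hX
  let res : Finset (Zn n) → (Zn n → ℂ) → (Zn n →₀ ℂ) := fun M F =>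
    Finsupp.onFinset M (fun μ => if μ ∈ M then F μ else 0) fun μ h => by
      by_contra h'; simp [h'] at h
  have hres : ∀ M F, (res M F).support ⊆ M := fun M F => Finsupp.support_onFinset_subset
  have hval : ∀ (M : Finset (Zn n)) (F : Zn n → ℂ), ∀ μ ∈ M, res M F μ = F μ := fun M F μ hμ => by
    simp [res, hμ]
  have hsq : ∀ M F, ENNReal.ofReal (l2norm (res M F)) ^ 2 = ∑ μ ∈ M, ‖F μ‖ₑ ^ 2 := fun M F => by
    rw [ofReal_l2norm_sq _ (hres M F)]
    exact Finset.sum_congr rfl fun μ hμ => by rw [hval M F μ hμ]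
  set H := res T fun τ => (starRingEnd ℂ) (c τ) with hH
  have hform : trilinearForm a (res M F) (res N G) H = ((∑ τ ∈ T, ‖c τ‖ ^ 2 : ℝ) : ℂ) := by
    rw [trilinearForm_eq_of_support_subset a _ _ _ (hres M F) (hres N G)]
    have : ∑ μ ∈ M, ∑ ν ∈ N, a μ ν * res M F μ * res N G ν * H (μ + ν) =
        ∑ μ ∈ M, ∑ ν ∈ N, a μ ν * F μ * G ν * H (μ + ν) :=
      Finset.sum_congr rfl fun μ hμ => Finset.sum_congr rfl fun ν hν => by
        rw [hval M F μ hμ, hval N G ν hν]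
    rw [this, ← sum_diagCoeff_mul a M N F G H]
    push_cast
    refine Finset.sum_congr rfl fun τ hτ => ?_
    rw [hH, hval T _ τ hτ, Complex.mul_conj']
  have hXform : X = ‖trilinearForm a (res M F) (res N G) H‖ₑ := by
    rw [hform, hX, ← ofReal_norm, Complex.norm_real, Real.norm_of_nonneg (by positivity),
      ENNReal.ofReal_sum_of_nonneg fun _ _ => by positivity]
    refine Finset.sum_congr rfl fun ρ _ => ?_
    rw [← ofReal_norm, ENNReal.ofReal_pow (norm_nonneg _)]
  have hXtop : X ≠ ⊤ := by
    rw [hX]; exact (ENNReal.sum_lt_top.2 fun ρ _ => ENNReal.pow_lt_top enorm_lt_top).ne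
  have hle := enorm_trilinearForm_le a (res M F) (res N G) H
  rw [← hXform] at hle
  have hHX : ENNReal.ofReal (l2norm H) ^ 2 = X := by
    rw [hH, hsq]; simp only [RCLike.enorm_conj, hX]
  by_cases h0 : X = 0
  · rw [h0]; exact zero_le
  refine (ENNReal.mul_le_mul_iff_left h0 hXtop).1 ?_
  calc X * X ≤ _ := mul_le_mul' hle hle
    _ = Bnorm a ^ 2 * ENNReal.ofReal (l2norm (res M F)) ^ 2 *
        ENNReal.ofReal (l2norm (res N G)) ^ 2 * ENNReal.ofReal (l2norm H) ^ 2 := by ring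
    _ = _ := by rw [hsq, hsq, hHX]

/-- Second half of the duality: Cauchy–Schwarz in `τ` between the diagonal coefficients and `H`. -/
lemma enorm_trilinearForm_sq_le (a : Zn n → Zn n → ℂ) (F G H : Zn n →₀ ℂ) (hH : l2norm H = 1) :
    ‖trilinearForm a F G H‖ₑ ^ 2 ≤
      ∫⁻ y in cube n, ‖bilinTrig a F.support G.support F G y‖ₑ ^ 2 := by
  rw [lintegral_bilinTrig_eq, trilinearForm, ← sum_diagCoeff_mul a F.support G.support F G H]
  set T := Finset.image₂ (· + ·) F.support G.support
  set c := diagCoeff a F.support G.support F G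
  have hHT : ∑ τ ∈ T, ‖H τ‖ₑ ^ 2 ≤ 1 := by
    have := ofReal_l2norm_sq H (Finset.subset_union_left (s₂ := T))
    rw [hH, ENNReal.ofReal_one, one_pow] at this
    rw [this]
    exact Finset.sum_le_sum_of_subset Finset.subset_union_right
  have hcs : ‖∑ τ ∈ T, c τ * H τ‖₊ ^ 2 ≤ (∑ τ ∈ T, ‖c τ‖₊ ^ 2) * ∑ τ ∈ T, ‖H τ‖₊ ^ 2 := by
    refine (pow_le_pow_left' (nnnorm_sum_le _ _) 2).trans ?_
    simp only [nnnorm_mul]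
    exact Finset.sum_mul_sq_le_sq_mul_sq T _ _
  calc ‖∑ τ ∈ T, c τ * H τ‖ₑ ^ 2 ≤ (∑ τ ∈ T, ‖c τ‖ₑ ^ 2) * ∑ τ ∈ T, ‖H τ‖ₑ ^ 2 := by
        simp only [enorm_eq_nnnorm]; exact_mod_cast hcs
    _ ≤ (∑ τ ∈ T, ‖c τ‖ₑ ^ 2) * 1 := by gcongr
    _ = _ := mul_one _

/-! ### Separation of variables by Fourier inversion. -/

lemma IsTestFunction.exists_support_bound {V : Type*} [NormedAddCommGroup V] [NormedSpace ℝ V]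
    {Φ : V → ℂ} (hΦ : IsTestFunction Φ) : ∃ R : ℝ, ∀ p, Φ p ≠ 0 → ‖p‖ ≤ R := by
  obtain ⟨R, hR⟩ := hΦ.2.isBounded.exists_norm_le
  exact ⟨R, fun p hp => hR p (subset_tsupport _ hp)⟩

/-- The Euclidean space of triples of frequencies. -/
abbrev Freq (n : ℕ) : Type := PiLp 2 fun _ : Fin 3 => Rn n

/-- Separation of variables: `e^{2πis y·(ξ+η)} Φ(ξ, η)` is, for `y` in the cube, an absolutely
convergent superposition of products of characters in `y`, `ξ` and `η`. -/
lemma exists_separation {Φ : Rn n × Rn n → ℂ} (hΦ : IsTestFunction Φ) (s : ℝ) :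
    ∃ (W : Freq n → ℂ) (θ : Rn n → ℂ) (r : ℝ), Continuous W ∧ Integrable W ∧ ContDiff ℝ ∞ θ ∧
      (∀ ξ, ‖θ ξ‖ ≤ 1) ∧ (∀ ξ, θ ξ ≠ 0 → ‖ξ‖ ≤ r) ∧
      ∀ y ∈ cube n, ∀ ξ η, ex (s * inner ℝ y (ξ + η)) * Φ (ξ, η) =
        θ ξ * θ η * ∫ w, W w * ex (inner ℝ (w 0) y + inner ℝ (w 1) ξ + inner ℝ (w 2) η) := by
  obtain ⟨R, hR⟩ := hΦ.exists_support_bound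
  obtain ⟨hs, hc⟩ := hΦ
  -- The inner ball contains the cube (norms at most `n`) and both coordinate projections of the set
  -- where `Φ` is nonzero (norms at most `R`). The absolute value is there because `R` may be
  -- negative.
  let b : ContDiffBump (0 : Rn n) := ⟨|R| + n + 1, |R| + n + 2, by positivity, by linarith⟩
  set θ : Rn n → ℂ := fun ξ => (b ξ : ℂ) with hθ
  have hθs : ContDiff ℝ ∞ θ := Complex.ofRealCLM.contDiff.comp b.contDiff
  have hθ1 : ∀ ξ, ‖ξ‖ ≤ |R| + n + 1 → θ ξ = 1 := fun ξ hξ => by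
    rw [hθ]; simp only
    rw [b.one_of_mem_closedBall (by simpa [b] using hξ)]; simp
  have hθr : ∀ ξ, θ ξ ≠ 0 → ‖ξ‖ ≤ |R| + n + 2 := fun ξ hξ => by
    by_contra h
    push Not at h
    exact hξ (by simp [hθ, b.zero_of_le_dist (x := ξ) (by simpa [b] using h.le)])
  -- The cutoff in the `y` variable `v 0` makes the coupled exponential compactly supported in all
  -- variables. Hence `Ψ` is Schwartz, and its Fourier transform is the integrable weight `W`.
  let Ψ : Freq n → ℂ := fun v => θ (v 0) * ex (s * inner ℝ (v 0) (v 1 + v 2)) * Φ (v 1, v 2)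
  have hp : ∀ i : Fin 3, ContDiff ℝ ∞ fun v : Freq n => v i := fun i =>
    (PiLp.proj 2 (fun _ : Fin 3 => Rn n) i : Freq n →L[ℝ] Rn n).contDiff
  have hΨs : ContDiff ℝ ∞ Ψ :=
    ((hθs.comp (hp 0)).mul (contDiff_ex.comp (contDiff_const.mul
      ((hp 0).inner ℝ ((hp 1).add (hp 2)))))).mul (hs.comp ((hp 1).prodMk (hp 2)))
  have hΨc : HasCompactSupport Ψ := by
    refine HasCompactSupport.intro (K := PiLp.homeomorph 2 (fun _ : Fin 3 => Rn n) ⁻¹'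
      (Set.univ.pi fun _ => Metric.closedBall 0 (|R| + n + 2)))
      ((PiLp.homeomorph 2 (fun _ : Fin 3 => Rn n)).isCompact_preimage.2
        (isCompact_univ_pi fun _ => isCompact_closedBall _ _)) fun v hv => ?_
    by_contra h
    have h0 : θ (v 0) ≠ 0 := fun h' => h (by simp [Ψ, h'])
    have h1 : Φ (v 1, v 2) ≠ 0 := fun h' => h (by simp [Ψ, h'])
    have h2 := hR _ h1
    rw [Prod.norm_def, max_le_iff] at h2
    have h3 := le_abs_self R
    have h4 : (0 : ℝ) ≤ n := by positivity
    refine hv fun i _ => ?_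
    rw [mem_closedBall_zero_iff]
    change ‖v i‖ ≤ _
    fin_cases i
    · exact hθr _ h0
    · exact h2.1.trans (by linarith)
    · exact h2.2.trans (by linarith)
  let ψ : 𝓢(Freq n, ℂ) := hΨc.toSchwartzMap hΨs
  let χ : 𝓢(Freq n, ℂ) := 𝓕 ψ
  refine ⟨χ, θ, |R| + n + 2, χ.continuous, χ.integrable, hθs, fun ξ => ?_, hθr, ?_⟩
  · rw [hθ]; simp only [Complex.norm_real, Real.norm_of_nonneg b.nonneg]; exact b.le_one
  intro y hy ξ η
  have hinv : ∀ v : Freq n, Ψ v = ∫ w, χ w * ex (inner ℝ w v) := by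
    intro v
    have h1 : Ψ v = (𝓕⁻ χ : 𝓢(Freq n, ℂ)) v := by
      rw [FourierTransform.fourierInv_fourier_eq]; rfl
    rw [h1, SchwartzMap.fourierInv_coe, Real.fourierInv_eq']
    refine integral_congr_ae (Filter.Eventually.of_forall fun w => ?_)
    simp only [smul_eq_mul, ex]
    rw [mul_comm]
    congr 2
    push_cast; ring
  have hv := hinv (WithLp.toLp 2 ![y, ξ, η])
  have hin : ∀ w : Freq n, inner ℝ w (WithLp.toLp 2 ![y, ξ, η] : Freq n) =
      inner ℝ (w 0) y + inner ℝ (w 1) ξ + inner ℝ (w 2) η := by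
    intro w
    simp [PiLp.inner_apply, Fin.sum_univ_three]
  simp_rw [hin] at hv
  rw [← hv]
  have hy1 : θ y = 1 := hθ1 y ((norm_le_of_mem_cube hy).trans (by linarith [abs_nonneg R]))
  change _ = θ ξ * θ η * (θ y * ex (s * inner ℝ y (ξ + η)) * Φ (ξ, η))
  -- Both sides vanish where `Φ` does; elsewhere every cutoff equals one.
  by_cases h : Φ (ξ, η) = 0
  · simp [h]
  · have h2 := hR _ h
    rw [Prod.norm_def, max_le_iff] at h2
    have h3 := le_abs_self R
    have h4 : (0 : ℝ) ≤ n := by positivity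
    rw [hθ1 ξ (h2.1.trans (by linarith)), hθ1 η (h2.2.trans (by linarith)), hy1]
    ring

/-! ### Packets: analysis and synthesis bounds. -/

/-- The modulated translate `e^{2πi k·(ξ-μ)} θ(ξ-μ)` of a window `θ`. -/
def packet (θ : Rn n → ℂ) (k : Rn n) (μ : Zn n) (ξ : Rn n) : ℂ :=
  ex (inner ℝ k (ξ - toRn μ)) * θ (ξ - toRn μ)

lemma norm_packet (θ : Rn n → ℂ) (k : Rn n) (μ : Zn n) (ξ : Rn n) :
    ‖packet θ k μ ξ‖ = ‖θ (ξ - toRn μ)‖ := by simp [packet]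

lemma continuous_packet_right {θ : Rn n → ℂ} (hθ : Continuous θ) (k : Rn n) (μ : Zn n) :
    Continuous (packet θ k μ) := by
  unfold packet; fun_prop

/-- The coefficient of `u` with respect to a packet, modulated by a lattice point `ρ`. -/
def packetCoeff (θ u : Rn n → ℂ) (k : Rn n) (ρ μ : Zn n) : ℂ :=
  ∫ ξ, ex (inner ℝ (toRn ρ) ξ) * (packet θ k μ ξ * u ξ)

lemma integrable_packet_mul {θ u : Rn n → ℂ} (hθ : Continuous θ) (hθ1 : ∀ ξ, ‖θ ξ‖ ≤ 1)
    (hu : Integrable u) (k : Rn n) (μ : Zn n) : Integrable fun ξ => packet θ k μ ξ * u ξ := by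
  refine hu.bdd_mul (c := 1) ?_ (Filter.Eventually.of_forall fun ξ => ?_)
  · exact (continuous_packet_right hθ k μ).aestronglyMeasurable
  · rw [norm_packet]; exact hθ1 _

lemma continuous_packetCoeff {θ u : Rn n → ℂ} (hθ : Continuous θ) (hθ1 : ∀ ξ, ‖θ ξ‖ ≤ 1)
    (hu : Integrable u) (ρ μ : Zn n) : Continuous fun k => packetCoeff θ u k ρ μ := by
  refine continuous_of_dominated (bound := fun ξ => ‖u ξ‖) (fun k => ?_) (fun k => ?_) hu.norm ?_
  · exact (Continuous.aestronglyMeasurable (by fun_prop)).mul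
      (integrable_packet_mul hθ hθ1 hu k μ).aestronglyMeasurable
  · refine Filter.Eventually.of_forall fun ξ => ?_
    rw [norm_mul, norm_mul, norm_ex, one_mul, norm_packet]
    exact mul_le_of_le_one_left (norm_nonneg _) (hθ1 _)
  · refine Filter.Eventually.of_forall fun ξ => ?_
    unfold packet
    fun_prop

/-- A family of translates of a window has bounded overlap. -/
lemma exists_sum_window_le (n : ℕ) (r : ℝ) : ∃ C : ℕ, ∀ θ : Rn n → ℂ, (∀ ξ, ‖θ ξ‖ ≤ 1) →
    (∀ ξ, θ ξ ≠ 0 → ‖ξ‖ ≤ r) → ∀ (M : Finset (Zn n)) (ξ : Rn n),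
      ∑ μ ∈ M, ‖θ (ξ - toRn μ)‖ₑ ^ 2 ≤ C := by
  classical
  obtain ⟨C, hC⟩ := exists_card_le n r
  refine ⟨C, fun θ h1 hr M ξ => ?_⟩
  calc ∑ μ ∈ M, ‖θ (ξ - toRn μ)‖ₑ ^ 2
      ≤ ∑ μ ∈ M, if ‖ξ - toRn μ‖ ≤ r then 1 else 0 := by
        refine Finset.sum_le_sum fun μ _ => ?_
        split_ifs with h
        · refine pow_le_one₀ zero_le ?_
          rw [← ofReal_norm]; exact ENNReal.ofReal_le_one.2 (h1 _)
        · have : θ (ξ - toRn μ) = 0 := by by_contra h'; exact h (hr _ h')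
          simp [this]
    _ = (M.filter fun μ => ‖ξ - toRn μ‖ ≤ r).card := by simp
    _ ≤ C := by
        exact_mod_cast hC ξ _ fun μ hμ => (Finset.mem_filter.1 hμ).2

/-- For each `μ`, Bessel's inequality in `ρ` applies to the piece of `u` in the ball of radius `r`
about `μ`; bounded overlap of the windows then sums over `μ`. Modulations have modulus one, so the
constant does not depend on `k`. -/
lemma exists_sum_packetCoeff_le (n : ℕ) (r : ℝ) : ∃ D : ℕ, ∀ θ : Rn n → ℂ, Continuous θ →
    (∀ ξ, ‖θ ξ‖ ≤ 1) → (∀ ξ, θ ξ ≠ 0 → ‖ξ‖ ≤ r) → ∀ u : Rn n → ℂ, Continuous u → Integrable u →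
    ∀ (k : Rn n) (M : Finset (Zn n)),
      ∑' ρ, ∑ μ ∈ M, ‖packetCoeff θ u k ρ μ‖ₑ ^ 2 ≤ D * ∫⁻ ξ, ‖u ξ‖ₑ ^ 2 := by
  obtain ⟨C, hC⟩ := exists_bessel n r
  obtain ⟨C', hC'⟩ := exists_sum_window_le n r
  refine ⟨C * C', fun θ hθ hθ1 hθr u hu hui k M => ?_⟩
  rw [Summable.tsum_finsetSum fun _ _ => ENNReal.summable]
  have hpc : ∀ μ, Continuous fun ξ => packet θ k μ ξ * u ξ := fun μ =>
    (continuous_packet_right hθ k μ).mul hu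
  calc ∑ μ ∈ M, ∑' ρ, ‖packetCoeff θ u k ρ μ‖ₑ ^ 2
      ≤ ∑ μ ∈ M, C * ∫⁻ ξ, ‖packet θ k μ ξ * u ξ‖ₑ ^ 2 := by
        refine Finset.sum_le_sum fun μ _ => hC (toRn μ) _ (hpc μ)
          (integrable_packet_mul hθ hθ1 hui k μ) fun ξ hξ => ?_
        rw [norm_sub_rev]
        refine hθr _ fun h => hξ ?_
        simp [packet, h]
    _ = C * ∫⁻ ξ, (∑ μ ∈ M, ‖θ (ξ - toRn μ)‖ₑ ^ 2) * ‖u ξ‖ₑ ^ 2 := by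
        rw [← Finset.mul_sum, ← lintegral_finsetSum]
        · congr 1
          refine lintegral_congr fun ξ => ?_
          rw [Finset.sum_mul]
          refine Finset.sum_congr rfl fun μ _ => ?_
          rw [enorm_mul, mul_pow, ← ofReal_norm (packet θ k μ ξ), norm_packet, ofReal_norm]
        · exact fun μ _ => (hpc μ).enorm.measurable.pow_const 2
    _ ≤ C * ∫⁻ ξ, C' * ‖u ξ‖ₑ ^ 2 := by
        gcongr with ξ; exact hC' θ hθ1 hθr M ξ
    _ = _ := by
        rw [lintegral_const_mul _ (hu.enorm.measurable.pow_const 2)]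
        push_cast; ring

/-- The superposition of packets with coefficients `F` has `L²` norm bounded by the `ℓ²` norm of
the coefficients. -/
lemma exists_lintegral_sum_packet_le {θ : Rn n → ℂ} {r : ℝ} (hθ : Continuous θ)
    (hθr : ∀ ξ, θ ξ ≠ 0 → ‖ξ‖ ≤ r) :
    ∃ D : ℝ≥0, ∀ (k : Rn n) (M : Finset (Zn n)) (F : Zn n → ℂ),
      ∫⁻ ξ, ‖∑ μ ∈ M, F μ * packet θ k μ ξ‖ₑ ^ 2 ≤ D * ∑ μ ∈ M, ‖F μ‖ₑ ^ 2 := by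
  classical
  obtain ⟨C, hC⟩ := exists_card_le n r
  have hcs : HasCompactSupport θ := by
    refine HasCompactSupport.intro (isCompact_closedBall (0 : Rn n) r) fun ξ hξ => ?_
    by_contra h
    exact hξ (by simpa using hθr ξ h)
  have hL : ∫⁻ ξ, ‖θ ξ‖ₑ ^ 2 < ⊤ := by
    have := (hθ.memLp_of_hasCompactSupport (p := 2) (μ := volume) hcs).2
    rw [← eLpNorm_two_sq]
    exact ENNReal.pow_lt_top this
  obtain ⟨L, hLeq⟩ : ∃ L : ℝ≥0, (L : ℝ≥0∞) = ∫⁻ ξ, ‖θ ξ‖ₑ ^ 2 :=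
    ⟨_, ENNReal.coe_toNNReal hL.ne⟩
  refine ⟨C * L, fun k M F => ?_⟩
  have hpm : ∀ μ, Measurable fun ξ => ‖F μ * packet θ k μ ξ‖ₑ ^ 2 := fun μ =>
    (continuous_const.mul (continuous_packet_right hθ k μ)).enorm.measurable.pow_const 2
  calc ∫⁻ ξ, ‖∑ μ ∈ M, F μ * packet θ k μ ξ‖ₑ ^ 2
      ≤ ∫⁻ ξ, C * ∑ μ ∈ M, ‖F μ * packet θ k μ ξ‖ₑ ^ 2 := by
        refine lintegral_mono fun ξ => ?_
        -- At a fixed `ξ` at most `C` packets are nonzero, so Cauchy–Schwarz for the sum costs only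
        -- the factor `C`.
        have hz : ∀ μ ∈ M, μ ∉ M.filter (fun μ => ‖ξ - toRn μ‖ ≤ r) →
            F μ * packet θ k μ ξ = 0 := by
          intro μ hμ hμ'
          have : θ (ξ - toRn μ) = 0 := by
            by_contra h'; exact hμ' (Finset.mem_filter.2 ⟨hμ, hθr _ h'⟩)
          simp [packet, this]
        rw [← Finset.sum_subset (Finset.filter_subset (fun μ => ‖ξ - toRn μ‖ ≤ r) M) hz]
        refine (sum_enorm_sq_le_card _ _).trans (mul_le_mul' ?_ ?_)
        · exact_mod_cast hC ξ _ fun μ hμ => (Finset.mem_filter.1 hμ).2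
        · exact Finset.sum_le_sum_of_subset (Finset.filter_subset _ _)
    _ = C * ∑ μ ∈ M, ‖F μ‖ₑ ^ 2 * ∫⁻ ξ, ‖θ (ξ - toRn μ)‖ₑ ^ 2 := by
        rw [lintegral_const_mul _ (Finset.measurable_fun_sum _ fun μ _ => hpm μ),
          lintegral_finsetSum _ fun μ _ => hpm μ]
        congr 1
        refine Finset.sum_congr rfl fun μ _ => ?_
        rw [← lintegral_const_mul' _ _ (ENNReal.pow_ne_top enorm_ne_top)]
        refine lintegral_congr fun ξ => ?_
        rw [enorm_mul, mul_pow, ← ofReal_norm (packet θ k μ ξ), norm_packet, ofReal_norm]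
    _ = _ := by
        have : ∀ μ : Zn n, ∫⁻ ξ, ‖θ (ξ - toRn μ)‖ₑ ^ 2 = L := fun μ => by
          rw [lintegral_sub_right_eq_self (fun ξ => ‖θ ξ‖ₑ ^ 2) (toRn μ), hLeq]
        simp_rw [this, ← Finset.sum_mul]
        push_cast
        ring

/-! ### Truncated multipliers and the operator on the frequency side. -/

lemma integrable_of_separated_bound {h : Rn n × Rn n → Freq n → ℂ}
    (hm : Measurable (Function.uncurry h)) {U V : Rn n → ℝ} {W : Freq n → ℝ}
    (hU : Integrable U) (hV : Integrable V) (hW : Integrable W)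
    (hb : ∀ p w, ‖h p w‖ ≤ U p.1 * V p.2 * W w) :
    Integrable (Function.uncurry h) (volume.prod volume) :=
  ((hU.mul_prod hV).mul_prod hW).mono' hm.aestronglyMeasurable
    (Filter.Eventually.of_forall fun q => hb q.1 q.2)

/-- The truncation of `sigma a Φ` to a finite set of lattice points. -/
def sigmaTrunc (a : Zn n → Zn n → ℂ) (Φ : Rn n × Rn n → ℂ) (M : Finset (Zn n))
    (p : Rn n × Rn n) : ℂ :=
  ∑ μ ∈ M, ∑ ν ∈ M, a μ ν * Φ (p.1 - toRn μ, p.2 - toRn ν)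

lemma IsTestFunction.exists_norm_bound {V : Type*} [NormedAddCommGroup V] [NormedSpace ℝ V]
    {Φ : V → ℂ} (hΦ : IsTestFunction Φ) : ∃ K : ℝ, ∀ p, ‖Φ p‖ ≤ K :=
  hΦ.2.exists_bound_of_continuous hΦ.1.continuous

lemma continuous_sigmaTrunc {Φ : Rn n × Rn n → ℂ} (hΦ : Continuous Φ) (a : Zn n → Zn n → ℂ)
    (M : Finset (Zn n)) : Continuous (sigmaTrunc a Φ M) := by
  unfold sigmaTrunc; fun_prop

/-- At each point at most `C` values of `μ` and `C` values of `ν` contribute. The bound is uniform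
in the truncation, which supplies the dominating functions for the limits below. -/
lemma exists_norm_sigmaTrunc_le {Φ : Rn n × Rn n → ℂ} (hΦ : IsTestFunction Φ)
    {a : Zn n → Zn n → ℂ} (ha : IsBoundedMatrix a) :
    ∃ K : ℝ, ∀ M p, ‖sigmaTrunc a Φ M p‖ ≤ K := by
  classical
  obtain ⟨R, hR⟩ := hΦ.exists_support_bound
  obtain ⟨K, hK⟩ := hΦ.exists_norm_bound
  obtain ⟨A, hA⟩ := ha
  obtain ⟨C, hC⟩ := exists_card_le n R
  have hA0 : 0 ≤ A := (norm_nonneg _).trans (hA 0 0)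
  have hK0 : 0 ≤ K := (norm_nonneg _).trans (hK 0)
  refine ⟨C * (C * (A * K)), fun M p => ?_⟩
  have hz : ∀ μ ν, ‖a μ ν * Φ (p.1 - toRn μ, p.2 - toRn ν)‖ ≤
      (if ‖p.1 - toRn μ‖ ≤ R then 1 else 0) * ((if ‖p.2 - toRn ν‖ ≤ R then 1 else 0) * (A * K)) := by
    intro μ ν
    by_cases h : Φ (p.1 - toRn μ, p.2 - toRn ν) = 0
    · rw [h, mul_zero, norm_zero]; positivity
    · have h2 := hR _ h
      rw [Prod.norm_def, max_le_iff] at h2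
      rw [if_pos h2.1, if_pos h2.2, one_mul, one_mul, norm_mul]
      exact mul_le_mul (hA _ _) (hK _) (norm_nonneg _) hA0
  have hcard : ∀ x : Rn n, ∑ μ ∈ M, (if ‖x - toRn μ‖ ≤ R then (1 : ℝ) else 0) ≤ C := fun x => by
    rw [Finset.sum_boole]
    exact_mod_cast hC x _ fun μ hμ => (Finset.mem_filter.1 hμ).2
  calc ‖sigmaTrunc a Φ M p‖ ≤ ∑ μ ∈ M, ∑ ν ∈ M, ‖a μ ν * Φ (p.1 - toRn μ, p.2 - toRn ν)‖ :=
        (norm_sum_le _ _).trans (Finset.sum_le_sum fun μ _ => norm_sum_le _ _)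
    _ ≤ ∑ μ ∈ M, ∑ ν ∈ M, (if ‖p.1 - toRn μ‖ ≤ R then (1 : ℝ) else 0) *
          ((if ‖p.2 - toRn ν‖ ≤ R then 1 else 0) * (A * K)) :=
        Finset.sum_le_sum fun μ _ => Finset.sum_le_sum fun ν _ => hz μ ν
    _ = (∑ μ ∈ M, if ‖p.1 - toRn μ‖ ≤ R then (1 : ℝ) else 0) *
          ((∑ ν ∈ M, if ‖p.2 - toRn ν‖ ≤ R then (1 : ℝ) else 0) * (A * K)) := by
        rw [Finset.sum_mul, Finset.sum_mul]
        simp_rw [Finset.mul_sum]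
    _ ≤ _ := by gcongr <;> exact hcard _

lemma tendsto_sigmaTrunc {Φ : Rn n × Rn n → ℂ} (hΦ : IsTestFunction Φ) (a : Zn n → Zn n → ℂ)
    (p : Rn n × Rn n) :
    Filter.Tendsto (fun M => sigmaTrunc a Φ M p) Filter.atTop (nhds (sigma a Φ p)) := by
  obtain ⟨R, hR⟩ := hΦ.exists_support_bound
  have hsum : Summable fun m : Zn n × Zn n =>
      a m.1 m.2 * Φ (p.1 - toRn m.1, p.2 - toRn m.2) := by
    refine summable_of_hasFiniteSupport
      (((finite_lattice_near p.1 R).prod (finite_lattice_near p.2 R)).subset fun m hm => ?_)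
    have h2 := hR _ (right_ne_zero_of_mul hm)
    rw [Prod.norm_def, max_le_iff] at h2
    exact h2
  have h := hsum.hasSum
  -- Square truncations are cofinal among the finite sets of pairs, so they compute the same sum.
  have hdiag : Filter.Tendsto (fun M : Finset (Zn n) => M ×ˢ M) Filter.atTop Filter.atTop :=
    Filter.tendsto_finsetProd_atTop.comp Filter.tendsto_atTop_diagonal
  have h2 := Filter.Tendsto.comp h hdiag
  refine h2.congr fun M => ?_
  simp only [Function.comp, sigmaTrunc, Finset.sum_product]

lemma measurable_sigma {Φ : Rn n × Rn n → ℂ} (hΦ : IsTestFunction Φ) (a : Zn n → Zn n → ℂ) :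
    Measurable (sigma a Φ) :=
  measurable_of_tendsto_metrizable' Filter.atTop
    (fun M => (continuous_sigmaTrunc hΦ.1.continuous a M).measurable)
    (tendsto_pi_nhds.2 fun p => tendsto_sigmaTrunc hΦ a p)

lemma exists_norm_sigma_le {Φ : Rn n × Rn n → ℂ} (hΦ : IsTestFunction Φ)
    {a : Zn n → Zn n → ℂ} (ha : IsBoundedMatrix a) : ∃ K : ℝ, ∀ p, ‖sigma a Φ p‖ ≤ K := by
  obtain ⟨K, hK⟩ := exists_norm_sigmaTrunc_le hΦ ha
  exact ⟨K, fun p => le_of_tendsto (tendsto_sigmaTrunc hΦ a p).norm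
    (Filter.Eventually.of_forall fun M => hK M p)⟩

/-- The bilinear operator in terms of the Fourier transforms of its arguments. -/
def freqOp (σ : Rn n × Rn n → ℂ) (u v : Rn n → ℂ) (x : Rn n) : ℂ :=
  ∫ p : Rn n × Rn n, ex (inner ℝ x (p.1 + p.2)) * σ p * u p.1 * v p.2

lemma bilinearOp_eq_freqOp (σ : Rn n × Rn n → ℂ) (f g : 𝓢(Rn n, ℂ)) :
    bilinearOp σ f g = freqOp σ (𝓕 (f : Rn n → ℂ)) (𝓕 (g : Rn n → ℂ)) := rfl

lemma integrable_freqOp {σ : Rn n × Rn n → ℂ} {u v : Rn n → ℂ} (hσ : Measurable σ) {K : ℝ}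
    (hK : ∀ p, ‖σ p‖ ≤ K) (hu : Integrable u) (hv : Integrable v) (x : Rn n) :
    Integrable fun p : Rn n × Rn n => ex (inner ℝ x (p.1 + p.2)) * σ p * u p.1 * v p.2 := by
  simp_rw [mul_assoc _ (u _) (v _)]
  refine (hu.mul_prod hv).bdd_mul (c := K) ?_ (Filter.Eventually.of_forall fun p => ?_)
  · exact (Measurable.mul (Continuous.measurable (by fun_prop)) hσ).aestronglyMeasurable
  · rw [norm_mul, norm_ex, one_mul]; exact hK p

lemma continuous_freqOp {σ : Rn n × Rn n → ℂ} {u v : Rn n → ℂ} (hσ : Measurable σ) {K : ℝ}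
    (hK : ∀ p, ‖σ p‖ ≤ K) (hu : Integrable u) (hv : Integrable v) :
    Continuous (freqOp σ u v) := by
  refine continuous_of_dominated (bound := fun p => K * ‖u p.1 * v p.2‖) (fun x =>
    (integrable_freqOp hσ hK hu hv x).aestronglyMeasurable) (fun x => ?_)
    ((hu.mul_prod hv).norm.const_mul K) ?_
  · refine Filter.Eventually.of_forall fun p => ?_
    rw [mul_assoc, norm_mul, norm_mul, norm_ex, one_mul]
    gcongr
    exact hK p
  · exact Filter.Eventually.of_forall fun p => by fun_prop

lemma tendsto_freqOp_sigmaTrunc {Φ : Rn n × Rn n → ℂ} (hΦ : IsTestFunction Φ)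
    {a : Zn n → Zn n → ℂ} (ha : IsBoundedMatrix a) {u v : Rn n → ℂ} (hu : Integrable u)
    (hv : Integrable v) (x : Rn n) :
    Filter.Tendsto (fun M => freqOp (sigmaTrunc a Φ M) u v x) Filter.atTop
      (nhds (freqOp (sigma a Φ) u v x)) := by
  obtain ⟨K, hK⟩ := exists_norm_sigmaTrunc_le hΦ ha
  refine tendsto_integral_filter_of_dominated_convergence (fun p => K * ‖u p.1 * v p.2‖)
    (Filter.Eventually.of_forall fun M => (integrable_freqOp
      (continuous_sigmaTrunc hΦ.1.continuous a M).measurable (hK M) hu hv x).aestronglyMeasurable)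
    (Filter.Eventually.of_forall fun M => Filter.Eventually.of_forall fun p => ?_)
    ((hu.mul_prod hv).norm.const_mul K) (Filter.Eventually.of_forall fun p => ?_)
  · rw [mul_assoc, norm_mul, norm_mul, norm_ex, one_mul]
    gcongr
    exact hK M p
  · exact ((tendsto_const_nhds.mul (tendsto_sigmaTrunc hΦ a p)).mul tendsto_const_nhds).mul
      tendsto_const_nhds

/-! ### The operator on a translated cube as a superposition of trigonometric polynomials. -/

lemma integrable_and_integral_separated {Φ : Rn n × Rn n → ℂ} {W : Freq n → ℂ} {θ : Rn n → ℂ}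
    (hW : Continuous W) (hWi : Integrable W) (hθ : Continuous θ) (hθ1 : ∀ ξ, ‖θ ξ‖ ≤ 1)
    {y : Rn n} (hsep : ∀ ξ η, ex (inner ℝ y (ξ + η)) * Φ (ξ, η) =
        θ ξ * θ η * ∫ w, W w * ex (inner ℝ (w 0) y + inner ℝ (w 1) ξ + inner ℝ (w 2) η))
    {u v : Rn n → ℂ} (hu : Continuous u) (hui : Integrable u) (hv : Continuous v)
    (hvi : Integrable v) (ρ μ ν : Zn n) :
    Integrable (fun w : Freq n => W w * ex (inner ℝ (w 0) y) *
        (packetCoeff θ u (w 1) ρ μ * packetCoeff θ v (w 2) ρ ν * ex (inner ℝ y (toRn (μ + ν))))) ∧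
      ∫ p : Rn n × Rn n, ex (inner ℝ (y + toRn ρ) (p.1 + p.2)) *
          Φ (p.1 - toRn μ, p.2 - toRn ν) * u p.1 * v p.2 =
        ∫ w : Freq n, W w * ex (inner ℝ (w 0) y) * (packetCoeff θ u (w 1) ρ μ *
          packetCoeff θ v (w 2) ρ ν * ex (inner ℝ y (toRn (μ + ν)))) := by
  let h : Rn n × Rn n → Freq n → ℂ := fun p w => W w * ex (inner ℝ (w 0) y) *
    ((ex (inner ℝ (toRn ρ) p.1) * (packet θ (w 1) μ p.1 * u p.1)) *
      (ex (inner ℝ (toRn ρ) p.2) * (packet θ (w 2) ν p.2 * v p.2)) *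
        ex (inner ℝ y (toRn (μ + ν))))
  have hc : Continuous (Function.uncurry h) := by
    unfold h packet Function.uncurry; fun_prop
  have hint : Integrable (Function.uncurry h) (volume.prod volume) := by
    refine integrable_of_separated_bound hc.measurable hui.norm hvi.norm hWi.norm fun p w => ?_
    simp only [h, norm_mul, norm_ex, one_mul, mul_one, norm_packet]
    have e1 := mul_le_of_le_one_left (norm_nonneg (u p.1)) (hθ1 (p.1 - toRn μ))
    have e2 := mul_le_of_le_one_left (norm_nonneg (v p.2)) (hθ1 (p.2 - toRn ν))
    rw [mul_comm]
    gcongr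
  have hw : ∀ w, ∫ p, h p w = W w * ex (inner ℝ (w 0) y) * (packetCoeff θ u (w 1) ρ μ *
      packetCoeff θ v (w 2) ρ ν * ex (inner ℝ y (toRn (μ + ν)))) := by
    intro w
    simp only [h]
    rw [integral_const_mul, integral_mul_const]
    congr 2
    exact integral_prod_mul (μ := volume) (ν := volume)
      (fun ξ => ex (inner ℝ (toRn ρ) ξ) * (packet θ (w 1) μ ξ * u ξ))
      (fun ξ => ex (inner ℝ (toRn ρ) ξ) * (packet θ (w 2) ν ξ * v ξ))
  have hp : ∀ p, ∫ w, h p w = ex (inner ℝ (y + toRn ρ) (p.1 + p.2)) *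
      Φ (p.1 - toRn μ, p.2 - toRn ν) * u p.1 * v p.2 := by
    intro p
    have e1 : ∀ w, h p w = (ex (inner ℝ (toRn ρ) p.1) * ex (inner ℝ (toRn ρ) p.2) * u p.1 * v p.2 *
        ex (inner ℝ y (toRn (μ + ν))) * θ (p.1 - toRn μ) * θ (p.2 - toRn ν)) *
        (W w * ex (inner ℝ (w 0) y + inner ℝ (w 1) (p.1 - toRn μ) +
          inner ℝ (w 2) (p.2 - toRn ν))) := by
      intro w
      simp only [h, packet, ex_add]
      ring
    simp_rw [e1]
    rw [integral_const_mul]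
    have e2 := hsep (p.1 - toRn μ) (p.2 - toRn ν)
    -- The `ρ` part already splits into functions of `ξ` and `η`. The `y` part is recentred at `(μ,
    -- ν)`, where the separation formula applies, and leaves the character of frequency `μ + ν`.
    have e3 : ex (inner ℝ (y + toRn ρ) (p.1 + p.2)) = ex (inner ℝ (toRn ρ) p.1) *
        ex (inner ℝ (toRn ρ) p.2) * ex (inner ℝ y (toRn (μ + ν))) *
        ex (inner ℝ y (p.1 - toRn μ + (p.2 - toRn ν))) := by
      simp only [← ex_add]
      congr 1
      simp only [toRn_add, inner_add_left, inner_add_right, inner_sub_right]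
      ring
    rw [e3]
    linear_combination (-(ex (inner ℝ (toRn ρ) p.1) * ex (inner ℝ (toRn ρ) p.2) * u p.1 * v p.2 *
        ex (inner ℝ y (toRn (μ + ν))))) * e2
  have hsw := integral_integral_swap hint
  simp_rw [hp, hw] at hsw
  refine ⟨?_, hsw⟩
  have := hint.integral_prod_right
  exact this.congr (Filter.Eventually.of_forall fun w => hw w)

lemma freqOp_sigmaTrunc_eq {Φ : Rn n × Rn n → ℂ} {W : Freq n → ℂ} {θ : Rn n → ℂ}
    (hΦ : IsTestFunction Φ)
    (hW : Continuous W) (hWi : Integrable W) (hθ : Continuous θ) (hθ1 : ∀ ξ, ‖θ ξ‖ ≤ 1)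
    {y : Rn n} (hsep : ∀ ξ η, ex (inner ℝ y (ξ + η)) * Φ (ξ, η) =
        θ ξ * θ η * ∫ w, W w * ex (inner ℝ (w 0) y + inner ℝ (w 1) ξ + inner ℝ (w 2) η))
    {u v : Rn n → ℂ} (hu : Continuous u) (hui : Integrable u) (hv : Continuous v)
    (hvi : Integrable v) (a : Zn n → Zn n → ℂ) (M : Finset (Zn n)) (ρ : Zn n) :
    freqOp (sigmaTrunc a Φ M) u v (y + toRn ρ) = ∫ w : Freq n, W w * ex (inner ℝ (w 0) y) *
      bilinTrig a M M (packetCoeff θ u (w 1) ρ) (packetCoeff θ v (w 2) ρ) y := by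
  have key := fun μ ν => integrable_and_integral_separated hW hWi hθ hθ1 hsep hu hui hv hvi ρ μ ν
  obtain ⟨K, hK⟩ := hΦ.exists_norm_bound
  have hI : ∀ μ ν : Zn n, Integrable fun p : Rn n × Rn n =>
      a μ ν * (ex (inner ℝ (y + toRn ρ) (p.1 + p.2)) * Φ (p.1 - toRn μ, p.2 - toRn ν) *
        u p.1 * v p.2) := fun μ ν => by
    have hc := hΦ.1.continuous
    exact (integrable_freqOp (σ := fun p => Φ (p.1 - toRn μ, p.2 - toRn ν))
      (Continuous.measurable (by fun_prop)) (fun p => hK _) hui hvi _).const_mul _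
  have hL : ∀ p : Rn n × Rn n, ex (inner ℝ (y + toRn ρ) (p.1 + p.2)) * sigmaTrunc a Φ M p *
      u p.1 * v p.2 = ∑ μ ∈ M, ∑ ν ∈ M, a μ ν * (ex (inner ℝ (y + toRn ρ) (p.1 + p.2)) *
        Φ (p.1 - toRn μ, p.2 - toRn ν) * u p.1 * v p.2) := by
    intro p
    simp only [sigmaTrunc, Finset.mul_sum, Finset.sum_mul]
    exact Finset.sum_congr rfl fun _ _ => Finset.sum_congr rfl fun _ _ => by ring
  have hR : ∀ w : Freq n, W w * ex (inner ℝ (w 0) y) *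
      bilinTrig a M M (packetCoeff θ u (w 1) ρ) (packetCoeff θ v (w 2) ρ) y =
      ∑ μ ∈ M, ∑ ν ∈ M, a μ ν * (W w * ex (inner ℝ (w 0) y) * (packetCoeff θ u (w 1) ρ μ *
          packetCoeff θ v (w 2) ρ ν * ex (inner ℝ y (toRn (μ + ν))))) := by
    intro w
    simp only [bilinTrig, Finset.mul_sum]
    exact Finset.sum_congr rfl fun _ _ => Finset.sum_congr rfl fun _ _ => by ring
  unfold freqOp
  simp_rw [hL, hR]
  rw [integral_finsetSum _ fun μ _ => integrable_finsetSum _ fun ν _ => hI μ ν,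
    integral_finsetSum _ fun μ _ => integrable_finsetSum _ fun ν _ => (key μ ν).1.const_mul _]
  refine Finset.sum_congr rfl fun μ _ => ?_
  rw [integral_finsetSum _ fun ν _ => hI μ ν,
    integral_finsetSum _ fun ν _ => (key μ ν).1.const_mul _]
  refine Finset.sum_congr rfl fun ν _ => ?_
  rw [integral_const_mul, integral_const_mul, (key μ ν).2]

/-! ### The upper bound in `(L², ℓ¹)`. -/

lemma eLpNorm_bilinTrig_le (a : Zn n → Zn n → ℂ) (M N : Finset (Zn n)) (F G : Zn n → ℂ) :
    eLpNorm (bilinTrig a M N F G) 2 (volume.restrict (cube n)) ≤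
      Bnorm a * ((∑ μ ∈ M, ‖F μ‖ₑ ^ 2) ^ (1 / 2 : ℝ) * (∑ ν ∈ N, ‖G ν‖ₑ ^ 2) ^ (1 / 2 : ℝ)) := by
  rw [eLpNorm_two_eq]
  refine (ENNReal.rpow_le_rpow (lintegral_bilinTrig_le a M N F G) (by norm_num)).trans_eq ?_
  rw [ENNReal.mul_rpow_of_nonneg _ _ (by norm_num), ENNReal.mul_rpow_of_nonneg _ _ (by norm_num),
    sq_rpow_half, mul_assoc]

lemma amalgamNorm_one_eq (p : ℝ≥0∞) (f : Rn n → ℂ) : amalgamNorm p 1 f =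
    ∑' ρ : Zn n, eLpNorm (fun x => f (x + toRn ρ)) p (volume.restrict (cube n)) := by
  rw [amalgamNorm, eLpNorm_one_eq_lintegral_enorm, lintegral_count]
  simp

/-- The estimate for truncated multipliers, uniform in the truncation. -/
lemma exists_amalgamNorm_sigmaTrunc_le {Φ : Rn n × Rn n → ℂ} (hΦ : IsTestFunction Φ) :
    ∃ c : ℝ≥0, ∀ (a : Zn n → Zn n → ℂ) (M : Finset (Zn n)) (u v : Rn n → ℂ),
      Continuous u → Integrable u → Continuous v → Integrable v →
      amalgamNorm 2 1 (freqOp (sigmaTrunc a Φ M) u v) ≤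
        c * Bnorm a * (L2norm u * L2norm v) := by
  obtain ⟨W, θ, r, hW, hWi, hθs, hθ1, hθr, hsep⟩ := exists_separation hΦ 1
  have hθ := hθs.continuous
  obtain ⟨D, hD⟩ := exists_sum_packetCoeff_le n r
  obtain ⟨I, hI⟩ : ∃ I : ℝ≥0, (I : ℝ≥0∞) = ∫⁻ w, ‖W w‖ₑ := ⟨_, ENNReal.coe_toNNReal hWi.2.ne⟩
  refine ⟨I * D, fun a M u v hu hui hv hvi => ?_⟩
  have hsep' : ∀ y ∈ cube n, ∀ ξ η, ex (inner ℝ y (ξ + η)) * Φ (ξ, η) =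
      θ ξ * θ η * ∫ w, W w * ex (inner ℝ (w 0) y + inner ℝ (w 1) ξ + inner ℝ (w 2) η) := by
    simpa only [one_mul] using hsep
  have hcoeff : ∀ {u : Rn n → ℂ}, Integrable u → ∀ (i : Fin 3) (ρ μ : Zn n),
      Continuous fun w : Freq n => packetCoeff θ u (w i) ρ μ := fun hui i ρ μ =>
    (continuous_packetCoeff hθ hθ1 hui ρ μ).comp (by fun_prop : Continuous fun w : Freq n => w i)
  let P : (Rn n → ℂ) → Rn n → Zn n → ℝ≥0∞ := fun u k ρ =>
    (∑ μ ∈ M, ‖packetCoeff θ u k ρ μ‖ₑ ^ 2) ^ (1 / 2 : ℝ)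
  have hPm : ∀ {u : Rn n → ℂ}, Integrable u → ∀ (i : Fin 3) (ρ : Zn n),
      Measurable fun w : Freq n => P u (w i) ρ := fun hui i ρ =>
    (Finset.measurable_fun_sum _ fun μ _ =>
      ((hcoeff hui i ρ μ).enorm.measurable.pow_const 2)).pow_const _
  have hPsum : ∀ {u : Rn n → ℂ}, Continuous u → Integrable u → ∀ k,
      (∑' ρ, P u k ρ ^ 2) ^ (1 / 2 : ℝ) ≤ (D : ℝ≥0∞) ^ (1 / 2 : ℝ) * L2norm u := by
    intro u hu hui k
    simp only [P, rpow_half_sq]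
    rw [L2norm, eLpNorm_two_eq, ← ENNReal.mul_rpow_of_nonneg _ _ (by norm_num)]
    exact ENNReal.rpow_le_rpow (hD θ hθ hθ1 hθr u hu hui k M) (by norm_num)
  rw [amalgamNorm_one_eq]
  calc ∑' ρ : Zn n, eLpNorm (fun x => freqOp (sigmaTrunc a Φ M) u v (x + toRn ρ)) 2
        (volume.restrict (cube n))
      ≤ ∑' ρ : Zn n, ∫⁻ w, ‖W w‖ₑ * (Bnorm a * (P u (w 1) ρ * P v (w 2) ρ)) := by
        refine ENNReal.tsum_le_tsum fun ρ => ?_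
        have e : (fun x => freqOp (sigmaTrunc a Φ M) u v (x + toRn ρ))
            =ᵐ[volume.restrict (cube n)] fun y => ∫ w : Freq n, W w * ex (inner ℝ (w 0) y) *
              bilinTrig a M M (packetCoeff θ u (w 1) ρ) (packetCoeff θ v (w 2) ρ) y := by
          filter_upwards [ae_restrict_mem (measurableSet_cube n)] with y hy
          exact freqOp_sigmaTrunc_eq hΦ hW hWi hθ hθ1 (hsep' y hy) hu hui hv hvi a M ρ
        rw [eLpNorm_congr_ae e]
        -- Minkowski moves the norm inside the `w`-integral; for fixed `w` the character in `y` is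
        -- unimodular and disappears.
        refine (eLpNorm_two_integral_le _ _ ?_).trans (lintegral_mono fun w => ?_)
        · refine Continuous.measurable ?_
          have h1 : ∀ μ, Continuous fun q : Freq n × Rn n => packetCoeff θ u (q.1 1) ρ μ :=
            fun μ => (hcoeff hui 1 ρ μ).comp continuous_fst
          have h2 : ∀ ν, Continuous fun q : Freq n × Rn n => packetCoeff θ v (q.1 2) ρ ν :=
            fun ν => (hcoeff hvi 2 ρ ν).comp continuous_fst
          have h3 : Continuous fun q : Freq n × Rn n => W q.1 * ex (inner ℝ (q.1 0) q.2) := by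
            fun_prop
          exact h3.mul (continuous_finsetSum _ fun μ _ => continuous_finsetSum _ fun ν _ =>
            ((continuous_const.mul (h1 μ)).mul (h2 ν)).mul (by fun_prop))
        · have e2 : eLpNorm (fun y => W w * ex (inner ℝ (w 0) y) * bilinTrig a M M
              (packetCoeff θ u (w 1) ρ) (packetCoeff θ v (w 2) ρ) y) 2 (volume.restrict (cube n)) =
              eLpNorm (W w • bilinTrig a M M (packetCoeff θ u (w 1) ρ)
                (packetCoeff θ v (w 2) ρ)) 2 (volume.restrict (cube n)) := by
            refine eLpNorm_congr_norm_ae (Filter.Eventually.of_forall fun y => ?_)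
            simp
          rw [e2, eLpNorm_const_smul]
          gcongr
          exact eLpNorm_bilinTrig_le _ _ _ _ _
    _ = ∫⁻ w, ‖W w‖ₑ * (Bnorm a * ∑' ρ : Zn n, P u (w 1) ρ * P v (w 2) ρ) := by
        rw [← lintegral_tsum]
        · simp only [ENNReal.tsum_mul_left]
        · exact fun ρ => (hW.enorm.measurable.mul (((hPm hui 1 ρ).mul
            (hPm hvi 2 ρ)).const_mul _)).aemeasurable
    _ ≤ ∫⁻ w, ‖W w‖ₑ * (Bnorm a * (D * (L2norm u * L2norm v))) := by
        refine lintegral_mono fun w => ?_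
        gcongr
        -- The product of two sequences that are square summable in `ρ` is summable: this is the
        -- source of the exponent `ℓ¹`.
        refine (tsum_mul_le_sqrt_mul_sqrt _ _).trans
          ((mul_le_mul' (hPsum hu hui _) (hPsum hv hvi _)).trans_eq ?_)
        calc _ = ((D : ℝ≥0∞) ^ (1 / 2 : ℝ)) ^ 2 * (L2norm u * L2norm v) := by ring
          _ = _ := by rw [rpow_half_sq]
    _ = _ := by
        rw [lintegral_mul_const _ hW.enorm.measurable, ← hI]
        push_cast
        ring

lemma L2norm_fourier (f : 𝓢(Rn n, ℂ)) : L2norm (𝓕 (f : Rn n → ℂ)) = L2norm f := by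
  have h1 : 𝓕 (f.toLp 2 volume) = (𝓕 f).toLp 2 volume := SchwartzMap.toLp_fourier_eq f
  have h2 := Lp.norm_fourier_eq (f.toLp 2 volume)
  rw [h1] at h2
  have h3 : ∀ g : 𝓢(Rn n, ℂ), L2norm g = ENNReal.ofReal ‖g.toLp 2 volume‖ := fun g => by
    rw [SchwartzMap.norm_toLp, ENNReal.ofReal_toReal (g.memLp 2 volume).2.ne, L2norm]
  rw [h3 f, ← SchwartzMap.fourier_coe, h3 (𝓕 f), h2]

/-- Fatou's lemma for the amalgam norm. -/
lemma amalgamNorm_le_of_tendsto {f : ℕ → Rn n → ℂ} {g : Rn n → ℂ} (hf : ∀ N, Continuous (f N))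
    (hlim : ∀ x, Filter.Tendsto (fun N => f N x) Filter.atTop (nhds (g x))) {K : ℝ≥0∞}
    (hK : ∀ N, amalgamNorm 2 1 (f N) ≤ K) : amalgamNorm 2 1 g ≤ K := by
  simp only [amalgamNorm_one_eq] at hK ⊢
  calc ∑' ρ : Zn n, eLpNorm (fun x => g (x + toRn ρ)) 2 (volume.restrict (cube n))
      ≤ ∑' ρ : Zn n, Filter.liminf (fun N => eLpNorm (fun x => f N (x + toRn ρ)) 2
          (volume.restrict (cube n))) Filter.atTop := by
        refine ENNReal.tsum_le_tsum fun ρ => Lp.eLpNorm_lim_le_liminf_eLpNorm (fun N => ?_) _ ?_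
        · have := hf N
          exact Continuous.aestronglyMeasurable (by fun_prop)
        · exact Filter.Eventually.of_forall fun x => hlim _
    _ ≤ Filter.liminf (fun N => ∑' ρ : Zn n, eLpNorm (fun x => f N (x + toRn ρ)) 2
          (volume.restrict (cube n))) Filter.atTop := by
        simp only [← lintegral_count]
        exact lintegral_liminf_le fun N => measurable_of_countable _
    _ ≤ K := (Filter.liminf_le_liminf (Filter.Eventually.of_forall hK)).trans (by simp)

theorem multiplierNorm_sigma_le {Φ : Rn n × Rn n → ℂ} (hΦ : IsTestFunction Φ) :
    ∃ c : ℝ≥0, 0 < c ∧ ∀ a : Zn n → Zn n → ℂ, IsBoundedMatrix a →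
      multiplierNorm L2norm L2norm (amalgamNorm 2 1) (sigma a Φ) ≤ (c : ℝ≥0∞) * Bnorm a := by
  obtain ⟨c, hc⟩ := exists_amalgamNorm_sigmaTrunc_le hΦ
  refine ⟨c + 1, by positivity, fun a ha => ?_⟩
  refine iSup_le fun f => iSup_le fun g => iSup_le fun hf => iSup_le fun hg => ?_
  -- Fatou's lemma needs a sequence, so an exhausting sequence of finite sets is extracted from the
  -- net.
  obtain ⟨M, hM⟩ := Filter.exists_seq_tendsto (Filter.atTop : Filter (Finset (Zn n)))
  obtain ⟨K, hK⟩ := exists_norm_sigmaTrunc_le hΦ ha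
  have hF : ∀ f : 𝓢(Rn n, ℂ), Continuous (𝓕 (f : Rn n → ℂ)) ∧ Integrable (𝓕 (f : Rn n → ℂ)) :=
    fun f => by
      rw [← SchwartzMap.fourier_coe]
      exact ⟨SchwartzMap.continuous _, SchwartzMap.integrable _⟩
  rw [bilinearOp_eq_freqOp]
  refine amalgamNorm_le_of_tendsto
    (f := fun N => freqOp (sigmaTrunc a Φ (M N)) (𝓕 (f : Rn n → ℂ)) (𝓕 (g : Rn n → ℂ)))
    (fun N => continuous_freqOp (continuous_sigmaTrunc hΦ.1.continuous a _).measurable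
      (hK (M N)) (hF f).2 (hF g).2)
    (fun x => (tendsto_freqOp_sigmaTrunc hΦ ha (hF f).2 (hF g).2 x).comp hM) fun N => ?_
  refine (hc a (M N) _ _ (hF f).1 (hF f).2 (hF g).1 (hF g).2).trans ?_
  rw [L2norm_fourier, L2norm_fourier, hf, hg, mul_one, mul_one]
  gcongr
  exact_mod_cast le_add_of_nonneg_right zero_le_one

/-! ### The lower bound in `(L², ℓ^∞)`. -/

lemma eLpNorm_cube_le_amalgamNorm_top (p : ℝ≥0∞) (f : Rn n → ℂ) :
    eLpNorm f p (volume.restrict (cube n)) ≤ amalgamNorm p ⊤ f := by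
  rw [amalgamNorm, eLpNorm_exponent_top, eLpNormEssSup, essSup_count]
  -- Only the cube at the origin is kept.
  refine le_iSup_of_le 0 ?_
  simp

lemma freqOp_smul_smul (σ : Rn n × Rn n → ℂ) (s t : ℂ) (u v : Rn n → ℂ) :
    freqOp σ (s • u) (t • v) = (s * t) • freqOp σ u v := by
  ext x
  simp only [freqOp, Pi.smul_apply, smul_eq_mul]
  rw [← integral_const_mul]
  exact integral_congr_ae (Filter.Eventually.of_forall fun p => by ring)

/-- Follows by bilinearity from the normalised case. Zero arguments are treated apart, since they
cannot be normalised. -/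
lemma eLpNorm_bilinearOp_le (σ : Rn n × Rn n → ℂ) (f g : 𝓢(Rn n, ℂ)) :
    eLpNorm (bilinearOp σ f g) 2 (volume.restrict (cube n)) ≤
      multiplierNorm L2norm L2norm (amalgamNorm 2 ⊤) σ * (L2norm f * L2norm g) := by
  have key : ∀ f : 𝓢(Rn n, ℂ), f ≠ 0 → ∃ (s : ℝ≥0) (f' : 𝓢(Rn n, ℂ)), L2norm f = s ∧
      L2norm f' = 1 ∧ 𝓕 (f : Rn n → ℂ) = ((s : ℝ) : ℂ) • 𝓕 (f' : Rn n → ℂ) := by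
    intro f hf
    have htop : L2norm f ≠ ⊤ := (f.memLp 2 volume).2.ne
    have h0 : L2norm f ≠ 0 := by
      intro h
      rw [L2norm, eLpNorm_eq_zero_iff f.continuous.aestronglyMeasurable (by norm_num)] at h
      have := (Continuous.ae_eq_iff_eq volume f.continuous continuous_zero).1 h
      exact hf (by ext x; simpa using congrFun this x)
    have h0' : (L2norm f).toNNReal ≠ 0 := by simp [ENNReal.toNNReal_eq_zero_iff, h0, htop]
    have h0c : (((L2norm f).toNNReal : ℝ) : ℂ) ≠ 0 := by exact_mod_cast h0'
    refine ⟨(L2norm f).toNNReal, ((((L2norm f).toNNReal : ℝ) : ℂ)⁻¹) • f,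
      (ENNReal.coe_toNNReal htop).symm, ?_, ?_⟩
    · have e : L2norm (((((L2norm f).toNNReal : ℝ) : ℂ)⁻¹) • f : 𝓢(Rn n, ℂ)) =
          ‖(((L2norm f).toNNReal : ℝ) : ℂ)⁻¹‖ₑ * L2norm f :=
        eLpNorm_const_smul _ (f : Rn n → ℂ) 2 volume
      have e2 : ‖(((L2norm f).toNNReal : ℝ) : ℂ)‖ₑ = L2norm f := by
        rw [← ofReal_norm, Complex.norm_real, Real.norm_of_nonneg (by positivity),
          ENNReal.ofReal_coe_nnreal, ENNReal.coe_toNNReal htop]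
      rw [e, enorm_inv h0c, e2, ENNReal.inv_mul_cancel h0 htop]
    · rw [← SchwartzMap.fourier_coe, ← SchwartzMap.fourier_coe, FourierTransform.fourier_smul]
      ext x
      simp [mul_inv_cancel_left₀ h0c]
  have hz : 𝓕 ((0 : 𝓢(Rn n, ℂ)) : Rn n → ℂ) = 0 := by
    ext ξ; simp [Real.fourier_eq']
  by_cases hf : f = 0
  · have : bilinearOp σ f g = 0 := by
      subst hf
      ext x
      simp only [bilinearOp, hz, Pi.zero_apply, mul_zero, zero_mul, integral_zero]
    rw [this]; simp
  by_cases hg : g = 0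
  · have : bilinearOp σ f g = 0 := by
      subst hg
      ext x
      simp only [bilinearOp, hz, Pi.zero_apply, mul_zero, integral_zero]
    rw [this]; simp
  obtain ⟨s, f', hs, hf', ef⟩ := key f hf
  obtain ⟨t, g', ht, hg', eg⟩ := key g hg
  have hle : eLpNorm (bilinearOp σ f' g') 2 (volume.restrict (cube n)) ≤
      multiplierNorm L2norm L2norm (amalgamNorm 2 ⊤) σ :=
    (eLpNorm_cube_le_amalgamNorm_top 2 _).trans <| le_iSup_of_le f' <| le_iSup_of_le g' <|
      le_iSup_of_le hf' <| le_iSup_of_le hg' le_rfl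
  rw [bilinearOp_eq_freqOp, ef, eg, freqOp_smul_smul, eLpNorm_const_smul, ← bilinearOp_eq_freqOp,
    hs, ht, mul_comm]
  refine (mul_le_mul' hle le_rfl).trans_eq ?_
  have he : ∀ s : ℝ≥0, ‖((s : ℝ) : ℂ)‖ₑ = s := fun s => by
    rw [← ofReal_norm, Complex.norm_real, Real.norm_of_nonneg s.coe_nonneg, ENNReal.ofReal_coe_nnreal]
  rw [enorm_mul, he, he]

/-- A superposition of packets is the Fourier transform of a Schwartz function. -/
lemma exists_fourier_eq_sum_packet {θ : Rn n → ℂ} {r : ℝ} (hθ : ContDiff ℝ ∞ θ)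
    (hθr : ∀ ξ, θ ξ ≠ 0 → ‖ξ‖ ≤ r) (k : Rn n) (M : Finset (Zn n)) (F : Zn n → ℂ) :
    ∃ f : 𝓢(Rn n, ℂ), 𝓕 (f : Rn n → ℂ) = fun ξ => ∑ μ ∈ M, F μ * packet θ k μ ξ := by
  have hs : ContDiff ℝ ∞ fun ξ => ∑ μ ∈ M, F μ * packet θ k μ ξ := by
    refine ContDiff.sum fun μ _ => contDiff_const.mul ?_
    unfold packet
    exact (contDiff_ex.comp (contDiff_const.inner ℝ (contDiff_id.sub contDiff_const))).mul
      (hθ.comp (contDiff_id.sub contDiff_const))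
  have hc : HasCompactSupport fun ξ => ∑ μ ∈ M, F μ * packet θ k μ ξ := by
    refine HasCompactSupport.intro (M.isCompact_biUnion fun μ _ =>
      isCompact_closedBall (toRn μ) r) fun ξ hξ => Finset.sum_eq_zero fun μ hμ => ?_
    have : θ (ξ - toRn μ) = 0 := by
      by_contra h
      exact hξ (Set.mem_biUnion hμ (by simpa [dist_eq_norm] using hθr _ h))
    simp [packet, this]
  refine ⟨𝓕⁻ (hc.toSchwartzMap hs), ?_⟩
  rw [← SchwartzMap.fourier_coe, FourierTransform.fourier_fourierInv_eq]
  rfl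

lemma integral_comp_sub_prod (h : Rn n × Rn n → ℂ) (q : Rn n × Rn n) :
    ∫ p, h (p - q) = ∫ p, h p := by
  have : (volume : Measure (Rn n × Rn n)).IsAddRightInvariant :=
    inferInstanceAs ((volume : Measure (Rn n)).prod (volume : Measure (Rn n))).IsAddRightInvariant
  exact integral_sub_right_eq_self h q

/-- Recovery of the matrix from the multiplier. -/
lemma integral_sigma_mul {Φ Θ : Rn n × Rn n → ℂ} (hΦ : IsTestFunction Φ) (hΘ : IsTestFunction Θ)
    (hA : ∀ α β : Zn n, ∫ p : Rn n × Rn n, Θ p * Φ (p.1 - toRn α, p.2 - toRn β) =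
      if α = 0 ∧ β = 0 then 1 else 0) {a : Zn n → Zn n → ℂ} (ha : IsBoundedMatrix a)
    (μ ν : Zn n) : ∫ p, sigma a Φ p * Θ (p.1 - toRn μ, p.2 - toRn ν) = a μ ν := by
  obtain ⟨K, hK⟩ := exists_norm_sigmaTrunc_le hΦ ha
  have hΦc := hΦ.1.continuous
  have hΘc := hΘ.1.continuous
  have hΘi : Integrable fun p : Rn n × Rn n => Θ (p.1 - toRn μ, p.2 - toRn ν) := by
    refine Continuous.integrable_of_hasCompactSupport (by fun_prop) ?_
    exact hΘ.2.comp_homeomorph (Homeomorph.subRight (toRn μ, toRn ν))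
  have hlim : Filter.Tendsto
      (fun M => ∫ p, sigmaTrunc a Φ M p * Θ (p.1 - toRn μ, p.2 - toRn ν)) Filter.atTop
      (nhds (∫ p, sigma a Φ p * Θ (p.1 - toRn μ, p.2 - toRn ν))) := by
    refine tendsto_integral_filter_of_dominated_convergence
      (fun p => K * ‖Θ (p.1 - toRn μ, p.2 - toRn ν)‖)
      (Filter.Eventually.of_forall fun M =>
        ((continuous_sigmaTrunc hΦc a M).aestronglyMeasurable.mul hΘi.aestronglyMeasurable))
      (Filter.Eventually.of_forall fun M => Filter.Eventually.of_forall fun p => ?_)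
      (hΘi.norm.const_mul K)
      (Filter.Eventually.of_forall fun p => (tendsto_sigmaTrunc hΦ a p).mul tendsto_const_nhds)
    rw [norm_mul]
    gcongr
    exact hK M p
  have hterm : ∀ μ' ν' : Zn n, ∫ p : Rn n × Rn n,
      a μ' ν' * (Φ (p.1 - toRn μ', p.2 - toRn ν') * Θ (p.1 - toRn μ, p.2 - toRn ν)) =
      if μ' = μ ∧ ν' = ν then a μ' ν' else 0 := by
    intro μ' ν'
    rw [integral_const_mul]
    have e := hA (μ' - μ) (ν' - ν)
    rw [← integral_comp_sub_prod _ (toRn μ, toRn ν)] at e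
    have e2 : ∀ p : Rn n × Rn n, Φ (p.1 - toRn μ', p.2 - toRn ν') *
        Θ (p.1 - toRn μ, p.2 - toRn ν) = Θ (p - (toRn μ, toRn ν)) *
        Φ ((p - (toRn μ, toRn ν)).1 - toRn (μ' - μ), (p - (toRn μ, toRn ν)).2 - toRn (ν' - ν)) := by
      intro p
      rw [mul_comm]
      congr 2
      simp [toRn_sub]
    simp_rw [e2]
    rw [e]
    simp [sub_eq_zero]
  -- The truncated integrals are eventually constant: once `M` contains `μ` and `ν`, biorthogonality
  -- leaves exactly the entry `a μ ν`.
  refine tendsto_nhds_unique hlim (tendsto_const_nhds.congr' ?_)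
  filter_upwards [Filter.eventually_ge_atTop ({μ, ν} : Finset (Zn n))] with M hM
  have hμ : μ ∈ M := hM (by simp)
  have hν : ν ∈ M := hM (by simp)
  have hI : ∀ μ' ν' : Zn n, Integrable fun p : Rn n × Rn n =>
      a μ' ν' * (Φ (p.1 - toRn μ', p.2 - toRn ν') * Θ (p.1 - toRn μ, p.2 - toRn ν)) := by
    intro μ' ν'
    obtain ⟨B, hB⟩ := hΦ.exists_norm_bound
    exact (hΘi.bdd_mul (c := B) (Continuous.aestronglyMeasurable (by fun_prop))
      (Filter.Eventually.of_forall fun p => hB _)).const_mul _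
  simp only [sigmaTrunc, Finset.sum_mul, mul_assoc]
  rw [integral_finsetSum _ fun μ' _ => integrable_finsetSum _ fun ν' _ => hI μ' ν']
  simp_rw [integral_finsetSum M fun ν' _ => hI _ ν', hterm]
  rw [Finset.sum_eq_single_of_mem μ hμ fun μ' _ h => Finset.sum_eq_zero fun ν' _ => by simp [h],
    Finset.sum_eq_single_of_mem ν hν fun ν' _ h => by simp [h]]
  simp

lemma continuous_sum_packet {X : Type*} [TopologicalSpace X] {θ : Rn n → ℂ} (hθ : Continuous θ)
    {k ξ : X → Rn n} (hk : Continuous k) (hξ : Continuous ξ) (M : Finset (Zn n))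
    (F : Zn n → ℂ) : Continuous fun x => ∑ μ ∈ M, F μ * packet θ (k x) μ (ξ x) := by
  unfold packet; fun_prop

/-- The trigonometric polynomial `bilinTrig` as a superposition of values of the bilinear
multiplier operator. -/
lemma bilinTrig_eq_integral_freqOp {Φ Θ : Rn n × Rn n → ℂ} (hΦ : IsTestFunction Φ)
    (hΘ : IsTestFunction Θ)
    (hA : ∀ α β : Zn n, ∫ p : Rn n × Rn n, Θ p * Φ (p.1 - toRn α, p.2 - toRn β) =
      if α = 0 ∧ β = 0 then 1 else 0)
    {W : Freq n → ℂ} {θ : Rn n → ℂ} {r : ℝ} (hW : Continuous W) (hWi : Integrable W)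
    (hθ : Continuous θ) (hθr : ∀ ξ, θ ξ ≠ 0 → ‖ξ‖ ≤ r) {y : Rn n}
    (hsep : ∀ ξ η, ex (-1 * inner ℝ y (ξ + η)) * Θ (ξ, η) =
      θ ξ * θ η * ∫ w, W w * ex (inner ℝ (w 0) y + inner ℝ (w 1) ξ + inner ℝ (w 2) η))
    {a : Zn n → Zn n → ℂ} (ha : IsBoundedMatrix a) (M N : Finset (Zn n)) (F G : Zn n → ℂ) :
    bilinTrig a M N F G y = ∫ w : Freq n, W w * ex (inner ℝ (w 0) y) *
      freqOp (sigma a Φ) (fun ξ => ∑ μ ∈ M, F μ * packet θ (w 1) μ ξ)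
        (fun ξ => ∑ ν ∈ N, G ν * packet θ (w 2) ν ξ) y := by
  obtain ⟨K, hK⟩ := exists_norm_sigma_le hΦ ha
  have hK0 : 0 ≤ K := (norm_nonneg _).trans (hK 0)
  have hσ := measurable_sigma hΦ a
  have hΘc := hΘ.1.continuous
  have hθi : Integrable θ := by
    refine hθ.integrable_of_hasCompactSupport (HasCompactSupport.intro
      (isCompact_closedBall (0 : Rn n) r) fun ξ hξ => ?_)
    by_contra h
    exact hξ (by simpa using hθr ξ h)
  have hUi : ∀ (M : Finset (Zn n)) (F : Zn n → ℂ),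
      Integrable fun ξ => ∑ μ ∈ M, ‖F μ‖ * ‖θ (ξ - toRn μ)‖ := fun M F =>
    integrable_finsetSum _ fun μ _ => ((hθi.comp_sub_right (toRn μ)).norm.const_mul _)
  have hUb : ∀ (M : Finset (Zn n)) (F : Zn n → ℂ) (k ξ : Rn n),
      ‖∑ μ ∈ M, F μ * packet θ k μ ξ‖ ≤ ∑ μ ∈ M, ‖F μ‖ * ‖θ (ξ - toRn μ)‖ := fun M F k ξ =>
    (norm_sum_le _ _).trans_eq (Finset.sum_congr rfl fun μ _ => by rw [norm_mul, norm_packet])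
  let h : Rn n × Rn n → Freq n → ℂ := fun p w => W w * ex (inner ℝ (w 0) y) *
    (ex (inner ℝ y (p.1 + p.2)) * sigma a Φ p * (∑ μ ∈ M, F μ * packet θ (w 1) μ p.1) *
      ∑ ν ∈ N, G ν * packet θ (w 2) ν p.2)
  have hm : Measurable (Function.uncurry h) := by
    have m1 : Continuous fun q : (Rn n × Rn n) × Freq n => W q.2 * ex (inner ℝ (q.2 0) y) := by
      fun_prop
    have m2 : Continuous fun q : (Rn n × Rn n) × Freq n => ex (inner ℝ y (q.1.1 + q.1.2)) := by
      fun_prop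
    have m3 : Continuous fun q : (Rn n × Rn n) × Freq n =>
        ∑ μ ∈ M, F μ * packet θ (q.2 1) μ q.1.1 :=
      continuous_sum_packet hθ (by fun_prop) (by fun_prop) M F
    have m4 : Continuous fun q : (Rn n × Rn n) × Freq n =>
        ∑ ν ∈ N, G ν * packet θ (q.2 2) ν q.1.2 :=
      continuous_sum_packet hθ (by fun_prop) (by fun_prop) N G
    exact m1.measurable.mul (((m2.measurable.mul (hσ.comp measurable_fst)).mul m3.measurable).mul
      m4.measurable)
  have hint : Integrable (Function.uncurry h) (volume.prod volume) := by
    refine integrable_of_separated_bound hm ((hUi M F).const_mul K) (hUi N G) hWi.norm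
      fun p w => ?_
    simp only [h, norm_mul, norm_ex, one_mul, mul_one]
    rw [mul_comm]
    gcongr
    · exact hK p
    · exact hUb M F _ _
    · exact hUb N G _ _
  have hw : ∀ w, ∫ p, h p w = W w * ex (inner ℝ (w 0) y) *
      freqOp (sigma a Φ) (fun ξ => ∑ μ ∈ M, F μ * packet θ (w 1) μ ξ)
        (fun ξ => ∑ ν ∈ N, G ν * packet θ (w 2) ν ξ) y := fun w => integral_const_mul _ _
  have hp : ∀ p, ∫ w, h p w = ∑ μ ∈ M, ∑ ν ∈ N, F μ * G ν * ex (inner ℝ y (toRn (μ + ν))) *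
      (sigma a Φ p * Θ (p.1 - toRn μ, p.2 - toRn ν)) := by
    intro p
    have e1 : ∀ w, h p w = ∑ μ ∈ M, ∑ ν ∈ N, (ex (inner ℝ y (p.1 + p.2)) * sigma a Φ p *
        (F μ * G ν) * (θ (p.1 - toRn μ) * θ (p.2 - toRn ν))) *
        (W w * ex (inner ℝ (w 0) y + inner ℝ (w 1) (p.1 - toRn μ) +
          inner ℝ (w 2) (p.2 - toRn ν))) := by
      intro w
      simp only [h, packet, ex_add]
      rw [mul_assoc _ (∑ μ ∈ M, _) (∑ ν ∈ N, _), Finset.sum_mul_sum]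
      simp only [Finset.mul_sum]
      exact Finset.sum_congr rfl fun _ _ => Finset.sum_congr rfl fun _ _ => by ring
    have hI : ∀ ξ η : Rn n, Integrable fun w : Freq n =>
        W w * ex (inner ℝ (w 0) y + inner ℝ (w 1) ξ + inner ℝ (w 2) η) := fun ξ η =>
      hWi.mul_bdd (c := 1) (Continuous.aestronglyMeasurable (by fun_prop))
        (Filter.Eventually.of_forall fun w => (norm_ex _).le)
    simp_rw [e1]
    rw [integral_finsetSum _ fun μ _ => integrable_finsetSum _ fun ν _ => (hI _ _).const_mul _]
    refine Finset.sum_congr rfl fun μ _ => ?_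
    rw [integral_finsetSum _ fun ν _ => (hI _ _).const_mul _]
    refine Finset.sum_congr rfl fun ν _ => ?_
    rw [integral_const_mul]
    have e2 := hsep (p.1 - toRn μ) (p.2 - toRn ν)
    -- The character of frequency `μ + ν` is traded for the kernel of the operator times an
    -- opposite, recentred exponential, which is absorbed into `Θ`; this is why the separation is
    -- used with sign `-1`.
    have e3 : ex (inner ℝ y (toRn (μ + ν))) = ex (inner ℝ y (p.1 + p.2)) *
        ex (-1 * inner ℝ y (p.1 - toRn μ + (p.2 - toRn ν))) := by
      rw [← ex_add]
      congr 1
      simp only [toRn_add, inner_add_right, inner_sub_right]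
      ring
    rw [e3]
    linear_combination (-(ex (inner ℝ y (p.1 + p.2)) * sigma a Φ p * (F μ * G ν))) * e2
  have hsw := integral_integral_swap hint
  simp_rw [hp, hw] at hsw
  rw [← hsw]
  have hΘi : ∀ μ ν : Zn n, Integrable fun p : Rn n × Rn n =>
      F μ * G ν * ex (inner ℝ y (toRn (μ + ν))) *
        (sigma a Φ p * Θ (p.1 - toRn μ, p.2 - toRn ν)) := fun μ ν => by
    have : Integrable fun p : Rn n × Rn n => Θ (p.1 - toRn μ, p.2 - toRn ν) :=
      Continuous.integrable_of_hasCompactSupport (by fun_prop)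
        (hΘ.2.comp_homeomorph (Homeomorph.subRight (toRn μ, toRn ν)))
    exact (this.bdd_mul (c := K) hσ.aestronglyMeasurable
      (Filter.Eventually.of_forall hK)).const_mul _
  rw [integral_finsetSum _ fun μ _ => integrable_finsetSum _ fun ν _ => hΘi μ ν, bilinTrig]
  refine Finset.sum_congr rfl fun μ _ => ?_
  rw [integral_finsetSum _ fun ν _ => hΘi μ ν]
  refine Finset.sum_congr rfl fun ν _ => ?_
  rw [integral_const_mul, integral_sigma_mul hΦ hΘ hA ha]
  ring

/-- Joint measurability in `(w, y)`, required by Minkowski's inequality. -/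
lemma measurable_superposition {σ : Rn n × Rn n → ℂ} (hσ : Measurable σ) {W : Freq n → ℂ}
    (hW : Continuous W) {θ : Rn n → ℂ} (hθ : Continuous θ) (M N : Finset (Zn n))
    (F G : Zn n → ℂ) :
    Measurable (Function.uncurry fun (w : Freq n) (y : Rn n) => W w * ex (inner ℝ (w 0) y) *
      freqOp σ (fun ξ => ∑ μ ∈ M, F μ * packet θ (w 1) μ ξ)
        (fun ξ => ∑ ν ∈ N, G ν * packet θ (w 2) ν ξ) y) := by
  have m1 : Continuous fun q : Freq n × Rn n => W q.1 * ex (inner ℝ (q.1 0) q.2) := by fun_prop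
  refine m1.measurable.mul (StronglyMeasurable.measurable ?_)
  refine StronglyMeasurable.integral_prod_right' (ν := (volume : Measure (Rn n × Rn n)))
    (f := fun q : (Freq n × Rn n) × (Rn n × Rn n) => ex (inner ℝ q.1.2 (q.2.1 + q.2.2)) * σ q.2 *
      (∑ μ ∈ M, F μ * packet θ (q.1.1 1) μ q.2.1) *
      ∑ ν ∈ N, G ν * packet θ (q.1.1 2) ν q.2.2) (Measurable.stronglyMeasurable ?_)
  have m2 : Continuous fun q : (Freq n × Rn n) × (Rn n × Rn n) =>
      ex (inner ℝ q.1.2 (q.2.1 + q.2.2)) := by fun_prop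
  have m3 : Continuous fun q : (Freq n × Rn n) × (Rn n × Rn n) =>
      ∑ μ ∈ M, F μ * packet θ (q.1.1 1) μ q.2.1 :=
    continuous_sum_packet hθ (by fun_prop) (by fun_prop) M F
  have m4 : Continuous fun q : (Freq n × Rn n) × (Rn n × Rn n) =>
      ∑ ν ∈ N, G ν * packet θ (q.1.1 2) ν q.2.2 :=
    continuous_sum_packet hθ (by fun_prop) (by fun_prop) N G
  exact ((m2.measurable.mul (hσ.comp measurable_snd)).mul m3.measurable).mul m4.measurable

theorem le_multiplierNorm_sigma {Φ : Rn n × Rn n → ℂ} (hΦ : IsTestFunction Φ)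
    (hA : ConditionA Φ) :
    ∃ c : ℝ≥0, 0 < c ∧ ∀ a : Zn n → Zn n → ℂ, IsBoundedMatrix a →
      (c : ℝ≥0∞)⁻¹ * Bnorm a ≤
        multiplierNorm L2norm L2norm (amalgamNorm 2 ⊤) (sigma a Φ) := by
  obtain ⟨Θ, hΘ, hA⟩ := hA
  obtain ⟨W, θ, r, hW, hWi, hθs, -, hθr, hsep⟩ := exists_separation hΘ (-1)
  have hθ := hθs.continuous
  obtain ⟨D, hD⟩ := exists_lintegral_sum_packet_le hθ hθr
  obtain ⟨I, hI⟩ : ∃ I : ℝ≥0, (I : ℝ≥0∞) = ∫⁻ w, ‖W w‖ₑ := ⟨_, ENNReal.coe_toNNReal hWi.2.ne⟩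
  -- `I` is the `L¹` norm of the weight and `D` collects a factor `D^{1/2}` from each of the two
  -- packet sums; adding one ensures positivity.
  refine ⟨I * D + 1, by positivity, fun a ha => ?_⟩
  set X := multiplierNorm L2norm L2norm (amalgamNorm 2 ⊤) (sigma a Φ) with hX
  rw [ENNReal.inv_mul_le_iff (by simp) ENNReal.coe_ne_top]
  refine iSup_le fun F => iSup_le fun G => iSup_le fun H => iSup_le fun hF => iSup_le fun hG =>
    iSup_le fun hH => ?_
  have hnorm : ∀ (F : Zn n →₀ ℂ), l2norm F = 1 → ∀ k, ∃ f : 𝓢(Rn n, ℂ),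
      𝓕 (f : Rn n → ℂ) = (fun ξ => ∑ μ ∈ F.support, F μ * packet θ k μ ξ) ∧
        L2norm f ≤ (D : ℝ≥0∞) ^ (1 / 2 : ℝ) := by
    intro F hF k
    obtain ⟨f, hf⟩ := exists_fourier_eq_sum_packet hθs hθr k F.support F
    refine ⟨f, hf, ?_⟩
    rw [← L2norm_fourier, hf, L2norm, eLpNorm_two_eq]
    refine ENNReal.rpow_le_rpow ((hD k F.support F).trans_eq ?_) (by norm_num)
    rw [← ofReal_l2norm_sq F subset_rfl, hF]
    simp
  have hop : ∀ k l, eLpNorm (freqOp (sigma a Φ) (fun ξ => ∑ μ ∈ F.support, F μ * packet θ k μ ξ)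
      (fun ξ => ∑ ν ∈ G.support, G ν * packet θ l ν ξ)) 2 (volume.restrict (cube n)) ≤ X * D := by
    intro k l
    obtain ⟨f, hf, hfn⟩ := hnorm F hF k
    obtain ⟨g, hg, hgn⟩ := hnorm G hG l
    rw [← hf, ← hg, ← bilinearOp_eq_freqOp]
    refine (eLpNorm_bilinearOp_le (sigma a Φ) f g).trans ?_
    rw [← hX]
    gcongr
    refine (mul_le_mul' hfn hgn).trans_eq ?_
    rw [← sq, rpow_half_sq]
  have e : bilinTrig a F.support G.support F G =ᵐ[volume.restrict (cube n)]
      fun y => ∫ w : Freq n, W w * ex (inner ℝ (w 0) y) *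
        freqOp (sigma a Φ) (fun ξ => ∑ μ ∈ F.support, F μ * packet θ (w 1) μ ξ)
          (fun ξ => ∑ ν ∈ G.support, G ν * packet θ (w 2) ν ξ) y := by
    filter_upwards [ae_restrict_mem (measurableSet_cube n)] with y hy
    exact bilinTrig_eq_integral_freqOp hΦ hΘ hA hW hWi hθ hθr (hsep y hy) ha _ _ F G
  calc ‖trilinearForm a F G H‖ₑ
      ≤ eLpNorm (bilinTrig a F.support G.support F G) 2 (volume.restrict (cube n)) := by
        rw [eLpNorm_two_eq, ← sq_rpow_half ‖trilinearForm a F G H‖ₑ]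
        exact ENNReal.rpow_le_rpow (enorm_trilinearForm_sq_le a F G H hH) (by norm_num)
    _ ≤ ∫⁻ w : Freq n, ‖W w‖ₑ * (X * D) := by
        rw [eLpNorm_congr_ae e]
        refine (eLpNorm_two_integral_le _ _ (measurable_superposition (measurable_sigma hΦ a) hW
          hθ _ _ F G)).trans (lintegral_mono fun w => ?_)
        have e2 : eLpNorm (fun y => W w * ex (inner ℝ (w 0) y) * freqOp (sigma a Φ)
            (fun ξ => ∑ μ ∈ F.support, F μ * packet θ (w 1) μ ξ)
            (fun ξ => ∑ ν ∈ G.support, G ν * packet θ (w 2) ν ξ) y) 2 (volume.restrict (cube n)) =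
            eLpNorm (W w • freqOp (sigma a Φ)
              (fun ξ => ∑ μ ∈ F.support, F μ * packet θ (w 1) μ ξ)
              (fun ξ => ∑ ν ∈ G.support, G ν * packet θ (w 2) ν ξ)) 2
              (volume.restrict (cube n)) := by
          refine eLpNorm_congr_norm_ae (Filter.Eventually.of_forall fun y => ?_)
          simp
        rw [e2, eLpNorm_const_smul]
        gcongr
        exact hop _ _
    _ = (I * D : ℝ≥0) * X := by
        rw [lintegral_mul_const _ hW.enorm.measurable, ← hI]
        push_cast
        ring
    _ ≤ _ := by
        gcongr
        exact le_add_of_nonneg_right zero_le_one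

end BilinearMultiplier

end

theorem theorem1p3 (n : ℕ) (Φ : BilinearMultiplier.Rn n × BilinearMultiplier.Rn n → ℂ)
    (hΦ : BilinearMultiplier.IsTestFunction Φ) :
    (∃ c : ℝ≥0, 0 < c ∧
      ∀ a : BilinearMultiplier.Zn n → BilinearMultiplier.Zn n → ℂ,
        BilinearMultiplier.IsBoundedMatrix a →
        BilinearMultiplier.multiplierNorm
            BilinearMultiplier.L2norm BilinearMultiplier.L2norm
            (BilinearMultiplier.amalgamNorm 2 1) (BilinearMultiplier.sigma a Φ) ≤
          (c : ℝ≥0∞) * BilinearMultiplier.Bnorm a) ∧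
    (BilinearMultiplier.ConditionA Φ →
      ∃ c : ℝ≥0, 0 < c ∧
      ∀ a : BilinearMultiplier.Zn n → BilinearMultiplier.Zn n → ℂ,
        BilinearMultiplier.IsBoundedMatrix a →
        (c : ℝ≥0∞)⁻¹ * BilinearMultiplier.Bnorm a ≤
          BilinearMultiplier.multiplierNorm
            BilinearMultiplier.L2norm BilinearMultiplier.L2norm
            (BilinearMultiplier.amalgamNorm 2 ∞) (BilinearMultiplier.sigma a Φ)) := by
  exact ⟨BilinearMultiplier.multiplierNorm_sigma_le hΦ,
    BilinearMultiplier.le_multiplierNorm_sigma hΦ⟩
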